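/- Let $\nu>0$, $2\nu+3\nu'\ge 0$, $\beta>0$, $\gamma>0$ and $\tilde\nu=\nu+\nu'$. On fields $U=(\phi,w,G)$ on $\mathbb R^3$ (with $\phi$ scalar, $w$ a vector field and $G$ a $3\times 3$-matrix field) let $$L(\phi,w,G)=\bigl(\operatorname{div}w,\ \gamma^2\nabla\phi-\nu\Delta w-\tilde\nu\nabla\operatorname{div}w-\beta^2\operatorname{div}G,\ -\nabla w\bigr),\qquad (\nabla w)^{jk}=\partial_{x_k}w^j,\quad (\operatorname{div}G)^j=\sum_{k=1}^3\partial_{x_k}G^{jk},$$ let $\hat L(\xi)$ be the symbol of $L$ (obtained by replacing $\partial_{x_k}$ by $i\xi_k$), and let $e^{-tL}=\mathcal F^{-1}e^{-t\hat L(\xi)}\mathcal F$, $t\ge0$, be the semigroup generated by $-L$ on $L^2(\mathbb R^3)$, where $\hat f(\xi)=\mathcal Ff(\xi)=(2\pi)^{-3/2}\int_{\mathbb R^3} f(x)e^{-i\xi\cdot x}\,dx$. Put $$M_1=\min\Bigl\{\tfrac{\beta}{\nu},\tfrac{\sqrt{\beta^2+\gamma^2}}{\nu+\tilde\nu}\Bigr\},\qquad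 M_2=\max\Bigl\{\tfrac{\beta}{\nu},\tfrac{\sqrt{\beta^2+\gamma^2}}{\nu+\tilde\nu}\Bigr\},$$ let $\hat\varphi_1,\hat\varphi_\infty\in C^\infty(\mathbb R^3;[0,1])$ be even functions such that $\hat\varphi_1(\xi)=1$ for $|\xi|\le M_1/2$, $\hat\varphi_1(\xi)=0$ for $|\xi|\ge M_1/\sqrt2$, $\hat\varphi_\infty(\xi)=1$ for $|\xi|\ge 2M_2$, $\hat\varphi_\infty(\xi)=0$ for $|\xi|\le\sqrt2M_2$, and put $\hat\varphi_M=1-\hat\varphi_1-\hat\varphi_\infty$ and $P_\infty u=\mathcal F^{-1}\bigl((\hat\varphi_M+\hat\varphi_\infty)\hat u\bigr)$ for $u\in L^2$. Then there are constants $C,c>0$, depending only on $\nu,\nu',\beta,\gamma$ and the cut-off functions, such that the following holds. Let $U_0=(\phi_0,w_0,G_0)\in W^{2,1}(\mathbb R^3)$ satisfy $\phi_0+\operatorname{tr}G_0=0$ almost everywhere and $G_0=\nabla\psi_0$ (in the weak sense) for some locally integrable vector field $\psi_0$. Then $U_0\in L^2(\mathbb R^3)$ (so that $P_\infty U_0$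 is defined), and for every $t>0$ one has $e^{-tL}P_\infty U_0\in L^1(\mathbb R^3)$ and $$\|e^{-tL}P_\infty U_0\|_{L^1}\le Ce^{-ct}\|U_0\|_{W^{2,1}}.$$ -/

import Mathlib

open MeasureTheory FourierTransform
open scoped ContDiff NNReal

noncomputable section

namespace Viscoelastic

/-- The physical space `ℝ³`. -/
abbrev E3 : Type := EuclideanSpace ℝ (Fin 3)

/-- Index set of the 13 scalar components of `U = (φ, w, G)`. -/
abbrev Comp : Type := Unit ⊕ Fin 3 ⊕ (Fin 3 × Fin 3)

/-- Values of `U = (φ, w, G)`: `φ` scalar, `w` a vector, `G` a `3 × 3` matrix, with the Euclidean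
norm `(|φ|² + |w|² + |G|²)^{1/2}`. -/
abbrev State : Type := EuclideanSpace ℂ Comp

/-- The space `L² = L² × (L²)³ × (L²)⁹`. -/
abbrev L2State : Type := Lp (α := E3) State 2

/-- The component `φ`. -/
def phi (u : State) : ℂ := u (Sum.inl ())

/-- The component `wʲ`. -/
def vel (u : State) (j : Fin 3) : ℂ := u (Sum.inr (Sum.inl j))

/-- The component `Gʲᵏ`. -/
def tens (u : State) (j k : Fin 3) : ℂ := u (Sum.inr (Sum.inr (j, k)))

/-- The coefficients of the system: viscosities `ν`, `ν'`, elastic wave speed `β` and sound speed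
`γ = √P'(1)`, with their standing assumptions. -/
structure Coeffs where
  ν : ℝ
  ν' : ℝ
  β : ℝ
  γ : ℝ
  ν_pos : 0 < ν
  visc_nonneg : 0 ≤ 2 * ν + 3 * ν'
  β_pos : 0 < β
  γ_pos : 0 < γ

/-- `ν̃ = ν + ν'`. -/
def Coeffs.νt (p : Coeffs) : ℝ := p.ν + p.ν'

/-! ### Classical derivatives and the linearized operator -/

/-- The partial derivative `∂_{x_k} f`. -/
def pd {F : Type*} [NormedAddCommGroup F] [NormedSpace ℝ F] (k : Fin 3) (f : E3 → F) : E3 → F :=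
  fun x => fderiv ℝ f x (EuclideanSpace.single k 1)

/-- `∂_x^α f = ∂_1^{α_1} ∂_2^{α_2} ∂_3^{α_3} f`. -/
def multiPd {F : Type*} [NormedAddCommGroup F] [NormedSpace ℝ F] (α : Fin 3 → ℕ) (f : E3 → F) :
    E3 → F :=
  (pd 0)^[α 0] ((pd 1)^[α 1] ((pd 2)^[α 2] f))

/-- The linearized operator
`L (φ, w, G) = (div w, γ²∇φ - νΔw - ν̃∇div w - β² div G, -∇w)`, acting on smooth fields, with
`(∇w)ʲᵏ = ∂_k wʲ` and `(div G)ʲ = ∑ₖ ∂_k Gʲᵏ`. -/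
def linOp (p : Coeffs) (U : E3 → State) (x : E3) : State :=
  WithLp.toLp 2 fun c => match c with
    | Sum.inl _ => ∑ k, pd k (fun y => vel (U y) k) x
    | Sum.inr (Sum.inl j) =>
        (p.γ : ℂ) ^ 2 * pd j (fun y => phi (U y)) x
          - (p.ν : ℂ) * ∑ k, pd k (pd k (fun y => vel (U y) j)) x
          - (p.νt : ℂ) * pd j (fun z => ∑ k, pd k (fun y => vel (U y) k) z) x
          - (p.β : ℂ) ^ 2 * ∑ k, pd k (fun y => tens (U y) j k) x
    | Sum.inr (Sum.inr (j, k)) => - pd k (fun y => vel (U y) j) x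

/-- The symbol `L̂(ξ)` of `L`, obtained by replacing `∂_k` by `iξ_k`; see `linOp_planeWave`. -/
def symbolMatrix (p : Coeffs) (ξ : E3) : Matrix Comp Comp ℂ := fun a b =>
  match a, b with
  | Sum.inl _, Sum.inr (Sum.inl k) => Complex.I * ξ k
  | Sum.inr (Sum.inl j), Sum.inl _ => Complex.I * (p.γ : ℂ) ^ 2 * ξ j
  | Sum.inr (Sum.inl j), Sum.inr (Sum.inl k) =>
      (if j = k then (p.ν : ℂ) * ∑ l, (ξ l : ℂ) ^ 2 else 0) + (p.νt : ℂ) * ξ j * ξ k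
  | Sum.inr (Sum.inl j), Sum.inr (Sum.inr (l, k)) =>
      if l = j then - Complex.I * (p.β : ℂ) ^ 2 * ξ k else 0
  | Sum.inr (Sum.inr (j, k)), Sum.inr (Sum.inl l) =>
      if l = j then - Complex.I * ξ k else 0
  | _, _ => 0

/-- The symbol `L̂(ξ)` as an operator on `ℂ¹³`. -/
def symbol (p : Coeffs) (ξ : E3) : State →L[ℂ] State :=
  Matrix.toEuclideanCLM (𝕜 := ℂ) (symbolMatrix p ξ)

lemma symbol_apply (p : Coeffs) (ξ : E3) (u : State) (c : Comp) :
    symbol p ξ u c = ∑ d, symbolMatrix p ξ c d * u d := by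
  rw [symbol, Matrix.ofLp_toEuclideanCLM]
  rfl

lemma pd_exp (ξ : E3) (k : Fin 3) (a : ℂ) :
    pd k (fun y : E3 => a * Complex.exp (Complex.I * (inner ℝ ξ y : ℝ))) =
      fun y => (a * (Complex.I * ξ k)) * Complex.exp (Complex.I * (inner ℝ ξ y : ℝ)) := by
  funext x
  have h1 : HasFDerivAt (fun y : E3 => (inner ℝ ξ y : ℝ)) (innerSL ℝ ξ) x :=
    (innerSL ℝ ξ).hasFDerivAt
  have h2 := (((Complex.ofRealCLM.hasFDerivAt.comp x h1).const_mul Complex.I).cexp).const_mul a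
  rw [pd]
  erw [h2.fderiv]
  simp [EuclideanSpace.inner_single_right]
  ring

/-- `L` acts on plane waves through its symbol: `L(e^{iξ·x} a) = e^{iξ·x} L̂(ξ) a`. -/
lemma linOp_planeWave (p : Coeffs) (ξ : E3) (a : State) (x : E3) :
    linOp p (fun y => Complex.exp (Complex.I * (inner ℝ ξ y : ℝ)) • a) x =
      Complex.exp (Complex.I * (inner ℝ ξ x : ℝ)) • symbol p ξ a := by
  have hsum : ∀ b : Fin 3 → ℂ,
      (fun z : E3 => ∑ k, b k * Complex.exp (Complex.I * (inner ℝ ξ z : ℝ))) =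
      fun z => (∑ k, b k) * Complex.exp (Complex.I * (inner ℝ ξ z : ℝ)) := fun b => by
    funext z; rw [Finset.sum_mul]
  have e : ∀ c : ℂ, (fun y : E3 => Complex.exp (Complex.I * (inner ℝ ξ y : ℝ)) * c) =
      fun y => c * Complex.exp (Complex.I * (inner ℝ ξ y : ℝ)) := fun c => by
    funext y; ring
  ext c
  rw [PiLp.smul_apply, symbol_apply]
  rcases c with c | j | ⟨j, k⟩
  · simp only [linOp, vel, phi, tens, PiLp.smul_apply, smul_eq_mul, e, pd_exp, symbolMatrix,
      Fintype.sum_sum_type, Fintype.sum_prod_type, Fin.sum_univ_three]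
    simp
    ring
  · simp only [linOp, vel, phi, tens, PiLp.smul_apply, smul_eq_mul, e, pd_exp, symbolMatrix,
      hsum]
    fin_cases j <;>
    · simp [Fintype.sum_sum_type, Fintype.sum_prod_type, Fin.sum_univ_three]
      ring_nf
      simp only [Complex.I_sq]
      ring
  · simp only [linOp, vel, phi, tens, PiLp.smul_apply, smul_eq_mul, e, pd_exp, symbolMatrix]
    simp [Fintype.sum_sum_type]
    ring

lemma continuous_symbol (p : Coeffs) : Continuous (symbol p) := by
  have h : Continuous (symbolMatrix p) := by
    refine continuous_pi fun a => continuous_pi fun b => ?_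
    rcases a with a | a | ⟨a, a'⟩ <;> rcases b with b | b | ⟨b, b'⟩ <;>
      simp only [symbolMatrix] <;> (try split_ifs) <;> fun_prop
  have h2 : Continuous (Matrix.toEuclideanCLM (n := Comp) (𝕜 := ℂ)) :=
    LinearMap.continuous_of_finiteDimensional
      ((Matrix.toEuclideanCLM (n := Comp) (𝕜 := ℂ)).toAlgEquiv.toLinearMap)
  exact h2.comp h

/-! ### Fourier multipliers on `L²` and the semigroup -/

lemma memLp_multiplier {m : E3 → State →L[ℂ] State} (hm : Continuous m)
    (hb : ∃ C : ℝ, ∀ ξ, ‖m ξ‖ ≤ C) (u : L2State) :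
    MemLp (fun ξ => m ((2 * Real.pi) • ξ) ((𝓕 u : L2State) ξ)) 2 (volume : Measure E3) := by
  obtain ⟨C, hC⟩ := hb
  have h1 : Continuous fun ξ : E3 => m ((2 * Real.pi) • ξ) := hm.comp (by fun_prop)
  refine MemLp.of_le_mul (c := C) (Lp.memLp (𝓕 u : L2State)) ?_ ?_
  · exact isBoundedBilinearMap_apply.continuous.comp_aestronglyMeasurable₂
      h1.aestronglyMeasurable (Lp.aestronglyMeasurable _)
  · exact Filter.Eventually.of_forall fun ξ => (m _).le_of_opNorm_le (hC _) _

/-- The Fourier multiplier `u ↦ 𝓕⁻¹(m(ξ) û(ξ))` on `L²`, where `m(ξ)` refers to the convention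
`û(ξ) = (2π)^{-3/2} ∫ u(x) e^{-iξ·x} dx`.  Mathlib's transform on `L²` is normalized by
`𝓕 u(ξ) = ∫ u(x) e^{-2πiξ·x} dx`, hence the dilation by `2π`. -/
def multiplier (m : E3 → State →L[ℂ] State) (hm : Continuous m)
    (hb : ∃ C : ℝ, ∀ ξ, ‖m ξ‖ ≤ C) (u : L2State) : L2State :=
  𝓕⁻ ((memLp_multiplier hm hb u).toLp)

/-- The symbol `exp(-t L̂(ξ))` of `e^{-tL}`. -/
def semigroupSymbol (p : Coeffs) (t : ℝ≥0) (ξ : E3) : State →L[ℂ] State :=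
  NormedSpace.exp (-(t : ℝ) • symbol p ξ)

lemma continuous_semigroupSymbol (p : Coeffs) (t : ℝ≥0) : Continuous (semigroupSymbol p t) := by
  let _ : NormedAlgebra ℚ (State →L[ℂ] State) := NormedAlgebra.restrictScalars ℚ ℂ _
  have h : Continuous fun ξ => -(t : ℝ) • symbol p ξ := (continuous_symbol p).const_smul (-(t : ℝ))
  exact NormedSpace.exp_continuous.comp h

/-- The weights of the energy `γ²|φ|² + |w|² + β²|G|²`. -/
def energyWeight (p : Coeffs) : Comp → ℝ
  | Sum.inl _ => p.γ ^ 2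
  | Sum.inr (Sum.inl _) => 1
  | Sum.inr (Sum.inr _) => p.β ^ 2

lemma symbol_dissipative (p : Coeffs) (ξ : E3) (v : State) :
    0 ≤ ∑ c, energyWeight p c * inner ℝ (v c) (symbol p ξ v c) := by
  have hnt : 0 ≤ p.νt := by
    have := p.ν_pos; have := p.visc_nonneg; simp only [Coeffs.νt]; linarith
  have key : ∑ c, energyWeight p c * inner ℝ (v c) (symbol p ξ v c) =
      p.ν * (∑ l, ξ l ^ 2) * (∑ j, Complex.normSq (vel v j)) +
      p.νt * Complex.normSq (∑ j, ξ j * vel v j) := by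
    simp only [symbol_apply, symbolMatrix, energyWeight, vel,
      Fintype.sum_sum_type, Fintype.sum_prod_type, Fin.sum_univ_three, Complex.inner]
    simp [Complex.normSq_apply, pow_two]
    ring
  rw [key]
  have := p.ν_pos.le
  have h1 : 0 ≤ ∑ l, ξ l ^ 2 := Finset.sum_nonneg fun _ _ => sq_nonneg _
  have h2 : 0 ≤ ∑ j, Complex.normSq (vel v j) :=
    Finset.sum_nonneg fun _ _ => Complex.normSq_nonneg _
  have h3 := Complex.normSq_nonneg (∑ j, (ξ j : ℂ) * vel v j)
  positivity

/-- For fixed `t ≥ 0` the symbol `exp(-t L̂(ξ))` is bounded in `ξ`. -/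
lemma bounded_semigroupSymbol (p : Coeffs) (t : ℝ≥0) :
    ∃ C : ℝ, ∀ ξ, ‖semigroupSymbol p t ξ‖ ≤ C := by
  have hw : ∀ c, 0 < energyWeight p c := by
    have := p.β_pos; have := p.γ_pos
    rintro (c | c | c) <;> simp only [energyWeight] <;> positivity
  set K : ℝ := ∑ c, energyWeight p c with hK
  set K' : ℝ := ∑ c, (energyWeight p c)⁻¹ with hK'
  have hKle : ∀ c, energyWeight p c ≤ K := fun c =>
    Finset.single_le_sum (fun c _ => (hw c).le) (Finset.mem_univ c)
  have hKle' : ∀ c, (energyWeight p c)⁻¹ ≤ K' := fun c =>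
    Finset.single_le_sum (f := fun c => (energyWeight p c)⁻¹)
      (fun c _ => (inv_pos.2 (hw c)).le) (Finset.mem_univ c)
  have hK0 : 0 ≤ K := Finset.sum_nonneg fun c _ => (hw c).le
  have hK0' : 0 ≤ K' := Finset.sum_nonneg fun c _ => (inv_pos.2 (hw c)).le
  have hup : ∀ v : State, ∑ c, energyWeight p c * ‖v c‖ ^ 2 ≤ K * ‖v‖ ^ 2 := fun v => by
    rw [EuclideanSpace.norm_sq_eq, Finset.mul_sum]
    exact Finset.sum_le_sum fun c _ => mul_le_mul_of_nonneg_right (hKle c) (sq_nonneg _)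
  have hlow : ∀ v : State, ‖v‖ ^ 2 ≤ K' * ∑ c, energyWeight p c * ‖v c‖ ^ 2 := fun v => by
    rw [EuclideanSpace.norm_sq_eq, Finset.mul_sum]
    refine Finset.sum_le_sum fun c _ => ?_
    rw [← mul_assoc]
    refine le_mul_of_one_le_left (sq_nonneg _) ?_
    have := mul_le_mul_of_nonneg_right (hKle' c) (hw c).le
    rwa [inv_mul_cancel₀ (hw c).ne'] at this
  refine ⟨Real.sqrt (K' * K), fun ξ => ?_⟩
  refine ContinuousLinearMap.opNorm_le_bound _ (Real.sqrt_nonneg _) fun a => ?_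
  let A : State →L[ℂ] State := -symbol p ξ
  let v : ℝ → State := fun s => NormedSpace.exp (s • A) a
  have hv : ∀ s, HasDerivAt v (A (v s)) s := fun s =>
    (((ContinuousLinearMap.apply ℂ State a).restrictScalars ℝ).hasFDerivAt.comp_hasDerivAt s
      (hasDerivAt_exp_smul_const' (𝕂 := ℝ) A s))
  have hvc : ∀ c s, HasDerivAt (fun s => v s c) (A (v s) c) s := fun c s =>
    (hasDerivAt_pi.1
      (((PiLp.continuousLinearEquiv 2 ℝ (fun _ : Comp => ℂ)).hasFDerivAt).comp_hasDerivAt s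
        (hv s))) c
  let e : ℝ → ℝ := fun s => ∑ c, energyWeight p c * ‖v s c‖ ^ 2
  have he : ∀ s, HasDerivAt e
      (∑ c, energyWeight p c * (2 * inner ℝ (v s c) (A (v s) c))) s := fun s =>
    HasDerivAt.fun_sum fun c _ => ((hvc c s).norm_sq).const_mul _
  have hanti : Antitone e := by
    refine antitone_of_deriv_nonpos (fun s => (he s).differentiableAt) fun s => ?_
    rw [(he s).deriv]
    have := symbol_dissipative p ξ (v s)
    have e2 : ∑ c, energyWeight p c * (2 * inner ℝ (v s c) (A (v s) c)) =
        -2 * ∑ c, energyWeight p c * inner ℝ (v s c) (symbol p ξ (v s) c) := by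
      rw [Finset.mul_sum]
      refine Finset.sum_congr rfl fun c _ => ?_
      simp only [A, neg_apply, PiLp.neg_apply, inner_neg_right]
      ring
    rw [e2]; linarith
  have h0 : v 0 = a := by
    have : (0 : ℝ) • A = 0 := zero_smul ℝ A
    simp only [v, this, NormedSpace.exp_zero, one_apply_eq_self]
  have ht : v t = semigroupSymbol p t ξ a := by
    have : (t : ℝ) • A = -(t : ℝ) • symbol p ξ := by
      rw [show A = -symbol p ξ from rfl, smul_neg]; exact (neg_smul (t : ℝ) (symbol p ξ)).symm
    simp only [v, this, semigroupSymbol]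
  have hfin : ‖semigroupSymbol p t ξ a‖ ^ 2 ≤ K' * K * ‖a‖ ^ 2 := by
    rw [← ht]
    calc ‖v t‖ ^ 2 ≤ K' * e t := hlow _
      _ ≤ K' * e 0 := mul_le_mul_of_nonneg_left (hanti t.2) hK0'
      _ ≤ K' * (K * ‖v 0‖ ^ 2) := mul_le_mul_of_nonneg_left (hup _) hK0'
      _ = K' * K * ‖a‖ ^ 2 := by rw [h0]; ring
  have := Real.sqrt_le_sqrt hfin
  rwa [Real.sqrt_sq (norm_nonneg _), Real.sqrt_mul (mul_nonneg hK0' hK0),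
    Real.sqrt_sq (norm_nonneg _)] at this

/-- The semigroup `e^{-tL} = 𝓕⁻¹ exp(-t L̂(ξ)) 𝓕` generated by `-L` on `L²`, `t ≥ 0`. -/
def semigroup (p : Coeffs) (t : ℝ≥0) : L2State → L2State :=
  multiplier (semigroupSymbol p t) (continuous_semigroupSymbol p t) (bounded_semigroupSymbol p t)

/-! ### Frequency cut-offs -/

/-- `M₁ = min {β/ν, √(β²+γ²)/(ν+ν̃)}`. -/
def M₁ (p : Coeffs) : ℝ := min (p.β / p.ν) (Real.sqrt (p.β ^ 2 + p.γ ^ 2) / (p.ν + p.νt))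

/-- `M₂ = max {β/ν, √(β²+γ²)/(ν+ν̃)}`. -/
def M₂ (p : Coeffs) : ℝ := max (p.β / p.ν) (Real.sqrt (p.β ^ 2 + p.γ ^ 2) / (p.ν + p.νt))

/-- The smooth even cut-off functions `φ̂₁` (low frequencies) and `φ̂_∞` (high frequencies), with
values in `[0, 1]`. -/
structure CutOffs (p : Coeffs) where
  low : E3 → ℝ
  high : E3 → ℝ
  low_smooth : ContDiff ℝ ∞ low
  high_smooth : ContDiff ℝ ∞ high
  low_mem : ∀ ξ, low ξ ∈ Set.Icc (0 : ℝ) 1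
  high_mem : ∀ ξ, high ξ ∈ Set.Icc (0 : ℝ) 1
  low_even : ∀ ξ, low (-ξ) = low ξ
  high_even : ∀ ξ, high (-ξ) = high ξ
  low_one : ∀ ξ, ‖ξ‖ ≤ M₁ p / 2 → low ξ = 1
  low_zero : ∀ ξ, M₁ p / Real.sqrt 2 ≤ ‖ξ‖ → low ξ = 0
  high_one : ∀ ξ, 2 * M₂ p ≤ ‖ξ‖ → high ξ = 1
  high_zero : ∀ ξ, ‖ξ‖ ≤ Real.sqrt 2 * M₂ p → high ξ = 0

/-- `φ̂_M = 1 - φ̂₁ - φ̂_∞`. -/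
def CutOffs.mid {p : Coeffs} (χ : CutOffs p) (ξ : E3) : ℝ := 1 - χ.low ξ - χ.high ξ

/-- The symbol `φ̂_M + φ̂_∞` of `P_∞`. -/
def CutOffs.projSymbol {p : Coeffs} (χ : CutOffs p) (ξ : E3) : State →L[ℂ] State :=
  (χ.mid ξ + χ.high ξ) • ContinuousLinearMap.id ℂ State

lemma CutOffs.continuous_projSymbol {p : Coeffs} (χ : CutOffs p) : Continuous χ.projSymbol := by
  have h1 := χ.low_smooth.continuous
  have h2 := χ.high_smooth.continuous
  unfold CutOffs.projSymbol CutOffs.mid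
  have h : Continuous fun ξ => 1 - χ.low ξ - χ.high ξ + χ.high ξ := by fun_prop
  exact h.smul continuous_const

lemma CutOffs.bounded_projSymbol {p : Coeffs} (χ : CutOffs p) :
    ∃ C : ℝ, ∀ ξ, ‖χ.projSymbol ξ‖ ≤ C := by
  refine ⟨1, fun ξ => ?_⟩
  have h := χ.low_mem ξ
  have h2 : |χ.mid ξ + χ.high ξ| ≤ 1 := by
    rw [abs_le, CutOffs.mid]; constructor <;> linarith [h.1, h.2]
  refine ContinuousLinearMap.opNorm_le_bound _ zero_le_one fun a => ?_
  simp only [CutOffs.projSymbol, smul_apply, ContinuousLinearMap.id_apply,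
    norm_smul, Real.norm_eq_abs]
  exact mul_le_mul_of_nonneg_right h2 (norm_nonneg _)

/-- `P_∞ u = 𝓕⁻¹((φ̂_M + φ̂_∞) û)` for `u ∈ L²`. -/
def projInfty {p : Coeffs} (χ : CutOffs p) : L2State → L2State :=
  multiplier χ.projSymbol χ.continuous_projSymbol χ.bounded_projSymbol

/-! ### Weak derivatives and Sobolev norms -/

/-- `g = ∂_x^α f` in the weak sense: both are locally integrable and
`∫ f ∂^α χ = (-1)^{|α|} ∫ g χ` for all test functions `χ ∈ C_c^∞(ℝ³)`. -/
def IsWeakDeriv {F : Type*} [NormedAddCommGroup F] [NormedSpace ℝ F] (α : Fin 3 → ℕ)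
    (f g : E3 → F) : Prop :=
  LocallyIntegrable f volume ∧ LocallyIntegrable g volume ∧
    ∀ χ : E3 → ℝ, ContDiff ℝ ∞ χ → HasCompactSupport χ →
      ∫ x, multiPd α χ x • f x = (-1 : ℝ) ^ (∑ k, α k) • ∫ x, χ x • g x

open Classical in
/-- The weak derivative `∂_x^α f` (unique almost everywhere), and `0` if there is none. -/
def weakDeriv {F : Type*} [NormedAddCommGroup F] [NormedSpace ℝ F] (α : Fin 3 → ℕ)
    (f : E3 → F) : E3 → F :=
  if h : ∃ g, IsWeakDeriv α f g then h.choose else 0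

/-- `f ∈ W^{m,1}`: all weak derivatives of order at most `m` exist and are integrable. -/
def MemW1 {F : Type*} [NormedAddCommGroup F] [NormedSpace ℝ F] (m : ℕ) (f : E3 → F) : Prop :=
  ∀ α : Fin 3 → ℕ, ∑ k, α k ≤ m → ∃ g, IsWeakDeriv α f g ∧ Integrable g volume

/-- `‖f‖_{W^{m,1}} = ∑_{|α| ≤ m} ‖∂_x^α f‖_{L¹}`. -/
def normW1 {F : Type*} [NormedAddCommGroup F] [NormedSpace ℝ F] (m : ℕ) (f : E3 → F) : ℝ :=
  ∑ n ∈ Finset.range (m + 1), ∑ α ∈ Finset.piAntidiag Finset.univ n, ∫ x, ‖weakDeriv α f x‖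

/-- `G = ∇ψ` for some vector field `ψ = (ψ¹, ψ², ψ³)`, i.e. `Gʲᵏ = ∂_k ψʲ` weakly. -/
def IsGradient (G : E3 → Fin 3 → Fin 3 → ℂ) : Prop :=
  ∃ ψ : Fin 3 → E3 → ℂ, ∀ j k, IsWeakDeriv (Pi.single k 1) (ψ j) (fun x => G x j k)

end Viscoelastic

end

namespace Viscoelastic

noncomputable section

/-! ### Fourier transforms on L¹ and L², compared by duality -/

section FourierDuality

variable {E F : Type*} [NormedAddCommGroup E] [InnerProductSpace ℝ E] [FiniteDimensional ℝ E]
  [MeasurableSpace E] [BorelSpace E] [NormedAddCommGroup F] [InnerProductSpace ℂ F]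
  [CompleteSpace F]

/-! Two derivatives of `U₀` are spent so that the evolution becomes a convolution with an integrable
kernel. Put V = (1 - Δ)U₀, which lies in L¹ with norm at most `normW1 2 U₀` (`MemW1.exists_bessel`).
Since φ̂_M + φ̂_∞ = 1 - φ̂₁, the solution equals K_t * V, where K_t has the symbol (1 - φ̂₁(ξ)) (1 +
|ξ|²)⁻¹ e^{-tL̂(ξ)} Π(ξ) and Π(ξ) projects onto the states satisfying φ + tr G = 0 and |ξ|² G = (Gξ)
⊗ ξ. The hypotheses on `U₀` say that its transform takes values in these states
(`constrained_fourier`), so inserting Π changes nothing; off them L̂ has stationary modes, and no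
decay could hold. By Young's inequality it remains to bound the L¹ norm of K_t by C e^{-ct}.

For this it suffices that the symbol and its first and second pure derivatives are O(e^{-ct} (1 +
|ξ|²)⁻¹). This bound is square integrable on ℝ³, so (1 + |x|²) K_t is in L² by Plancherel, and (1 +
|x|²)⁻¹ is in L² as well (`exists_integrable_kernel`).

The derivatives come from Cauchy's estimates: the symbol extends holomorphically to complex
frequencies ζ, and it is enough to bound it when one coordinate moves by a complex s with |s| ≤ δ,
where δ does not depend on the frequency (`exists_decaySymbol_bound`). On constrained states the
system at ζ splits into scalar equations b'' + A z b' + B z b = 0 with z = ζ·ζ: the compressible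
part has A = ν + ν̃, B = β² + γ², and the remaining part has A = ν, B = β²
(`exists_constrained_decay`). A Lyapunov functional gives exponential decay uniformly for z near
[ρ₀², ∞) (`exists_damped_decay`). No eigenvalues are computed, so frequencies with double
eigenvalues need no separate treatment. The rate does not improve as |ξ| grows, so all decay in ξ
comes from (1 + |ξ|²)⁻¹. -/

lemma integral_fourier_smul_Lp (f : Lp (α := E) F 2) (φ : SchwartzMap E ℂ) :
    ∫ x, (𝓕 φ) x • f x = ∫ x, φ x • (𝓕 f : Lp (α := E) F 2) x := by
  have h := congrArg (fun T => T φ) (Lp.fourier_toTemperedDistribution_eq f)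
  simpa [TemperedDistribution.fourier_apply] using h

lemma integral_fourier_smul_of_integrable {f : E → F} (hf : Integrable f)
    (φ : SchwartzMap E ℂ) : ∫ x, (𝓕 φ) x • f x = ∫ x, φ x • 𝓕 f x := by
  have h := VectorFourier.integral_fourierIntegral_smul_eq_flip (e := Real.fourierChar)
    (L := innerₗ E) (μ := volume) (ν := volume) (f := φ) (g := f)
    Real.continuous_fourierChar continuous_inner φ.integrable hf
  rw [flip_innerₗ] at h
  exact h

lemma ae_eq_of_forall_schwartz {f g : E → F} (hf : LocallyIntegrable f)
    (hg : LocallyIntegrable g)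
    (h : ∀ φ : SchwartzMap E ℂ, ∫ x, φ x • f x = ∫ x, φ x • g x) : f =ᵐ[volume] g := by
  refine ae_eq_of_integral_contDiff_smul_eq hf hg fun χ hχ hc => ?_
  have h1 : HasCompactSupport (Complex.ofRealCLM ∘ χ) := hc.comp_left rfl
  have h2 : ContDiff ℝ ∞ (Complex.ofRealCLM ∘ χ) := by fun_prop
  simpa using h (h1.toSchwartzMap h2)

/-- Every Schwartz function is a Fourier transform, so these test functions still separate. -/
lemma ae_eq_of_forall_fourier {f g : E → F} (hf : LocallyIntegrable f)
    (hg : LocallyIntegrable g)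
    (h : ∀ φ : SchwartzMap E ℂ, ∫ x, (𝓕 φ) x • f x = ∫ x, (𝓕 φ) x • g x) :
    f =ᵐ[volume] g := by
  refine ae_eq_of_forall_schwartz hf hg fun φ => ?_
  simpa using h (𝓕⁻ φ)

/-- Injectivity across the two definitions of the transform: both pairings with 𝓕φ move the
transform onto the other factor. Since `f` is not assumed to be in L², this also serves to prove
that it is. -/
lemma ae_eq_of_fourier_ae_eq {f : E → F} (hf : Integrable f) (g : Lp (α := E) F 2)
    (h : (𝓕 g : Lp (α := E) F 2) =ᵐ[volume] 𝓕 f) : f =ᵐ[volume] g := by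
  refine ae_eq_of_forall_fourier hf.locallyIntegrable
    ((Lp.memLp g).locallyIntegrable one_le_two) fun φ => ?_
  rw [integral_fourier_smul_of_integrable hf, integral_fourier_smul_Lp]
  refine integral_congr_ae ?_
  filter_upwards [h] with x hx
  rw [hx]

omit [CompleteSpace F] in
lemma continuous_fourier_of_integrable {f : E → F} (hf : Integrable f) : Continuous (𝓕 f) :=
  VectorFourier.fourierIntegral_continuous Real.continuous_fourierChar continuous_inner hf

lemma fourier_toLp_ae_eq {f : E → F} (hf : Integrable f) (hf2 : MemLp f 2) :
    (𝓕 hf2.toLp : Lp (α := E) F 2) =ᵐ[volume] 𝓕 f := by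
  have hc : Continuous (𝓕 f) := continuous_fourier_of_integrable hf
  refine ae_eq_of_forall_schwartz ((Lp.memLp _).locallyIntegrable one_le_two)
    hc.locallyIntegrable fun φ => ?_
  rw [← integral_fourier_smul_of_integrable hf, ← integral_fourier_smul_Lp]
  refine integral_congr_ae ?_
  filter_upwards [hf2.coeFn_toLp] with x hx
  rw [hx]

/-- The L² inverse transform of 𝓕 f is a square integrable function with the same transform as `f`,
hence equal to it. -/
lemma memLp_two_of_memLp_fourier {f : E → F} (hf : Integrable f) (h : MemLp (𝓕 f) 2) :
    MemLp f 2 := by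
  let g : Lp (α := E) F 2 := 𝓕⁻ (h.toLp (𝓕 f))
  have h1 : f =ᵐ[volume] g := by
    refine ae_eq_of_fourier_ae_eq hf g ?_
    rw [fourier_fourierInv_eq]
    exact h.coeFn_toLp
  exact (memLp_congr_ae h1).2 (Lp.memLp g)

end FourierDuality

/-! ### Integrable kernels from decaying symbols -/

section Kernel

variable {F : Type*} [NormedAddCommGroup F] [InnerProductSpace ℂ F] [CompleteSpace F]

/-- The square decays like |x|⁻⁴, and 4 > 3. This is the only place where the dimension limits the
required decay of symbols. -/
lemma memLp_inv_one_add_sq :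
    MemLp (fun x : E3 => (1 + ‖x‖ ^ 2)⁻¹) 2 := by
  have hc : Continuous fun x : E3 => (1 + ‖x‖ ^ 2)⁻¹ :=
    Continuous.inv₀ (by fun_prop) fun x => by positivity
  rw [memLp_two_iff_integrable_sq hc.aestronglyMeasurable]
  have h := integrable_one_add_norm (E := E3) (μ := volume) (r := 4) (by simp; norm_num)
  refine (h.const_mul 4).mono' (hc.pow 2).aestronglyMeasurable
    (Filter.Eventually.of_forall fun x => ?_)
  have hx := norm_nonneg x
  rw [Real.norm_of_nonneg (by positivity), Real.rpow_neg (by positivity), ← div_eq_mul_inv,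
    inv_pow, inv_eq_one_div, div_le_div_iff₀ (by positivity) (by positivity)]
  norm_cast
  nlinarith [sq_nonneg (‖x‖ - 1), pow_le_pow_left₀ (by positivity : 0 ≤ (1 + ‖x‖) ^ 2)
    (show (1 + ‖x‖) ^ 2 ≤ 2 * (1 + ‖x‖ ^ 2) by nlinarith [sq_nonneg (‖x‖ - 1)]) 2]

omit [InnerProductSpace ℂ F] [CompleteSpace F] in
lemma memLp_two_of_decay {k : E3 → F} (hk : Continuous k) {B : ℝ}
    (h : ∀ ξ, ‖k ξ‖ ≤ B * (1 + ‖ξ‖ ^ 2)⁻¹) : MemLp k 2 := by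
  refine MemLp.of_le_mul (c := B) memLp_inv_one_add_sq hk.aestronglyMeasurable
    (Filter.Eventually.of_forall fun ξ => ?_)
  rw [Real.norm_of_nonneg (by positivity : 0 ≤ (1 + ‖ξ‖ ^ 2)⁻¹)]
  exact h ξ

omit [CompleteSpace F] in
lemma continuous_pd {f : E3 → F} (hf : ContDiff ℝ 1 f) (j : Fin 3) : Continuous (pd j f) := by
  unfold pd
  exact (hf.continuous_fderiv one_ne_zero).clm_apply continuous_const

omit [CompleteSpace F] in
lemma contDiff_pd {n : ℕ∞} {f : E3 → F} (hf : ContDiff ℝ (n + 1) f) (j : Fin 3) :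
    ContDiff ℝ n (pd j f) := by
  unfold pd
  exact (hf.fderiv_right le_rfl).clm_apply contDiff_const

omit [CompleteSpace F] in
lemma integrable_schwartz_smul (ψ : SchwartzMap E3 ℂ) {g : E3 → F} (hg : Continuous g) {B : ℝ}
    (h : ∀ ξ, ‖g ξ‖ ≤ B) : Integrable fun x => ψ x • g x := by
  refine (ψ.integrable.norm.mul_const B).mono' (ψ.continuous.smul hg).aestronglyMeasurable
    (Filter.Eventually.of_forall fun x => ?_)
  rw [norm_smul]
  exact mul_le_mul_of_nonneg_left (h x) (norm_nonneg _)

omit [CompleteSpace F] in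
lemma integral_pd_schwartz_smul (ψ : SchwartzMap E3 ℂ) {g : E3 → F} (hg : ContDiff ℝ 1 g)
    (j : Fin 3) {B : ℝ} (h : ∀ ξ, ‖g ξ‖ ≤ B) (h' : ∀ ξ, ‖pd j g ξ‖ ≤ B) :
    ∫ x, (LineDeriv.lineDerivOp (EuclideanSpace.single j (1 : ℝ)) ψ) x • g x
      = - ∫ x, ψ x • pd j g x := by
  have key := integral_bilinear_hasLineDerivAt_right_eq_neg_left_of_integrable (E := E3)
    (μ := volume) (f := ψ) (f' := fun x => (LineDeriv.lineDerivOp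
      (EuclideanSpace.single j (1 : ℝ)) ψ) x) (g := g) (g' := pd j g)
    (v := EuclideanSpace.single j (1 : ℝ)) (B := ContinuousLinearMap.lsmul ℝ ℂ)
    (by simpa using integrable_schwartz_smul _ hg.continuous h)
    (by simpa using integrable_schwartz_smul ψ (continuous_pd hg j) h')
    (by simpa using integrable_schwartz_smul ψ hg.continuous h)
    (fun x _ => by
      rw [SchwartzMap.lineDerivOp_apply_eq_fderiv]
      exact (ψ.differentiable x).hasFDerivAt.hasLineDerivAt _)
    (fun x _ => (hg.differentiable one_ne_zero x).hasFDerivAt.hasLineDerivAt _)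
  simp only [ContinuousLinearMap.lsmul_apply] at key
  rw [key, neg_neg]

lemma fourier_lineDerivOp_sq (ψ : SchwartzMap E3 ℂ) (j : Fin 3) (x : E3) :
    (𝓕 (LineDeriv.lineDerivOp (EuclideanSpace.single j (1 : ℝ))
      (LineDeriv.lineDerivOp (EuclideanSpace.single j (1 : ℝ)) ψ))) x
      = -((2 * Real.pi * x j) ^ 2 : ℝ) • (𝓕 ψ) x := by
  have hg : (fun y : E3 => inner ℝ y (EuclideanSpace.single j (1 : ℝ))).HasTemperateGrowth := by
    fun_prop
  rw [SchwartzMap.fourier_lineDerivOp_eq, SchwartzMap.fourier_lineDerivOp_eq]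
  rw [smul_apply, SchwartzMap.smulLeftCLM_apply_apply hg, smul_apply,
    SchwartzMap.smulLeftCLM_apply_apply hg]
  simp [EuclideanSpace.inner_single_right]
  ring_nf
  simp [Complex.I_sq]

/-- Tested against 𝓕ψ: the factor -(2πx_j)² turns 𝓕ψ into 𝓕(∂_j²ψ), the transform is moved to the
other side, and two integrations by parts put ∂_j² on `k`. The bounds by `B` serve only to make the
products with Schwartz functions integrable. -/
lemma sq_smul_fourierInv_ae_eq {k : E3 → F} (hk : ContDiff ℝ 2 k) (j : Fin 3) {B : ℝ}
    (h0 : ∀ ξ, ‖k ξ‖ ≤ B) (h1 : ∀ ξ, ‖pd j k ξ‖ ≤ B) (h2 : ∀ ξ, ‖pd j (pd j k) ξ‖ ≤ B)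
    (m0 : MemLp k 2) (m2 : MemLp (pd j (pd j k)) 2) :
    (fun x => (-((2 * Real.pi * x j) ^ 2 : ℝ)) • (𝓕⁻ m0.toLp : Lp (α := E3) F 2) x)
      =ᵐ[volume] (𝓕⁻ m2.toLp : Lp (α := E3) F 2) := by
  have hk1 : ContDiff ℝ 1 (pd j k) := contDiff_pd (n := 1) hk j
  have hL : ∀ f : Lp (α := E3) F 2, LocallyIntegrable f :=
    fun f => (Lp.memLp f).locallyIntegrable one_le_two
  refine ae_eq_of_forall_fourier ?_ (hL _) fun ψ => ?_
  · have : Continuous fun x : E3 => -((2 * Real.pi * x j) ^ 2 : ℝ) := by fun_prop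
    exact locallyIntegrableOn_univ.1 (((hL _).locallyIntegrableOn Set.univ).continuousOn_smul
      isOpen_univ.isLocallyClosed this.continuousOn)
  · rw [integral_fourier_smul_Lp, fourier_fourierInv_eq]
    have e1 : ∀ x (v : F), (𝓕 ψ) x • ((-((2 * Real.pi * x j) ^ 2 : ℝ)) • v) =
        (𝓕 (LineDeriv.lineDerivOp (EuclideanSpace.single j (1 : ℝ))
          (LineDeriv.lineDerivOp (EuclideanSpace.single j (1 : ℝ)) ψ))) x • v := fun x v => by
      rw [fourier_lineDerivOp_sq, smul_assoc, smul_comm]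
    simp_rw [e1]
    rw [integral_fourier_smul_Lp, fourier_fourierInv_eq]
    have e2 : ∀ (φ : SchwartzMap E3 ℂ) {f : E3 → F} (hf : MemLp f 2),
        ∫ x, φ x • hf.toLp f x = ∫ x, φ x • f x := fun φ f hf => by
      refine integral_congr_ae ?_
      filter_upwards [hf.coeFn_toLp] with x hx
      rw [hx]
    rw [e2, e2, integral_pd_schwartz_smul _ (hk.of_le one_le_two) j h0 h1,
      integral_pd_schwartz_smul _ hk1 j h1 h2, neg_neg]

omit [CompleteSpace F] in
lemma integral_norm_sq_eq (f : Lp (α := E3) F 2) : ∫ x, ‖f x‖ ^ 2 = ‖f‖ ^ 2 := by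
  have h := inner_self_eq_norm_sq_to_K (𝕜 := ℂ) f
  rw [L2.inner_def] at h
  simp_rw [inner_self_eq_norm_sq_to_K] at h
  exact_mod_cast h

omit [InnerProductSpace ℂ F] [CompleteSpace F] in
lemma integrable_norm_sq (f : Lp (α := E3) F 2) : Integrable fun x => ‖f x‖ ^ 2 := by
  exact (memLp_two_iff_integrable_sq_norm (Lp.memLp f).1).1 (Lp.memLp f)

lemma integral_norm_sq_fourierInv_le {k : E3 → F} {B : ℝ}
    (h : ∀ ξ, ‖k ξ‖ ≤ B * (1 + ‖ξ‖ ^ 2)⁻¹) (m : MemLp k 2) :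
    ∫ x, ‖(𝓕⁻ (m.toLp k) : Lp (α := E3) F 2) x‖ ^ 2
      ≤ B ^ 2 * ∫ x : E3, ((1 + ‖x‖ ^ 2)⁻¹) ^ 2 := by
  have e := (Lp.fourierTransformₗᵢ E3 F).symm.norm_map (m.toLp k)
  change ‖𝓕⁻ (m.toLp k)‖ = _ at e
  rw [integral_norm_sq_eq, e, ← integral_norm_sq_eq, ← integral_const_mul]
  refine integral_mono_ae (integrable_norm_sq _)
    (((memLp_two_iff_integrable_sq memLp_inv_one_add_sq.1).1 memLp_inv_one_add_sq).const_mul _) ?_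
  filter_upwards [m.coeFn_toLp] with x hx
  rw [hx, ← mul_pow]
  exact pow_le_pow_left₀ (norm_nonneg _) (h x) 2

/-- A symbol that is `O((1 + |ξ|²)⁻¹)` together with its first and second derivatives is the
Fourier transform of an integrable kernel. -/
lemma exists_integrable_kernel : ∃ C > 0, ∀ (B : ℝ), 0 < B → ∀ k : E3 → F, ContDiff ℝ 2 k →
    (∀ ξ, ‖k ξ‖ ≤ B * (1 + ‖ξ‖ ^ 2)⁻¹) →
    (∀ j ξ, ‖pd j k ξ‖ ≤ B * (1 + ‖ξ‖ ^ 2)⁻¹) →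
    (∀ j ξ, ‖pd j (pd j k) ξ‖ ≤ B * (1 + ‖ξ‖ ^ 2)⁻¹) →
    ∃ K : E3 → F, Integrable K ∧ 𝓕 K =ᵐ[volume] k ∧ ∫ x, ‖K x‖ ≤ C * B := by
  set W : ℝ := ∫ x : E3, ((1 + ‖x‖ ^ 2)⁻¹) ^ 2 with hW
  have hW0 : 0 ≤ W := integral_nonneg fun x => by positivity
  have hWi : Integrable fun x : E3 => ((1 + ‖x‖ ^ 2)⁻¹) ^ 2 :=
    (memLp_two_iff_integrable_sq memLp_inv_one_add_sq.1).1 memLp_inv_one_add_sq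
  -- The two halves of the majorant `D` below contribute 2BW each; the 1 only makes the constant
  -- visibly positive.
  refine ⟨4 * W + 1, by positivity, fun B hB k hk h0 h1 h2 => ?_⟩
  have hdec : ∀ x : E3, B * (1 + ‖x‖ ^ 2)⁻¹ ≤ B := fun x => by
    refine mul_le_of_le_one_right hB.le (inv_le_one_of_one_le₀ ?_)
    have := sq_nonneg ‖x‖
    linarith
  have hk1 : ∀ j, ContDiff ℝ 1 (pd j k) := fun j => contDiff_pd (n := 1) hk j
  have m0 : MemLp k 2 := memLp_two_of_decay hk.continuous h0
  have m2 : ∀ j, MemLp (pd j (pd j k)) 2 := fun j =>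
    memLp_two_of_decay (continuous_pd (hk1 j) j) (h2 j)
  let K : Lp (α := E3) F 2 := 𝓕⁻ (m0.toLp k)
  let H : Fin 3 → Lp (α := E3) F 2 := fun j => 𝓕⁻ ((m2 j).toLp (pd j (pd j k)))
  have hH : ∀ j, (fun x => (-((2 * Real.pi * x j) ^ 2 : ℝ)) • K x) =ᵐ[volume] H j := fun j =>
    sq_smul_fourierInv_ae_eq hk j (fun ξ => (h0 ξ).trans (hdec ξ))
      (fun ξ => (h1 j ξ).trans (hdec ξ)) (fun ξ => (h2 j ξ).trans (hdec ξ)) m0 (m2 j)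
  have hHall : ∀ᵐ x, ∀ j, (-((2 * Real.pi * x j) ^ 2 : ℝ)) • K x = H j x :=
    ae_all_iff.2 hH
  -- With g = (1 + |x|²)⁻¹, the pointwise bound is ‖K‖ ≤ g (‖K‖ + ∑ ‖H j‖). Young's inequality g a ≤
  -- a²/(2B) + B g²/2, applied to these four terms, replaces Cauchy–Schwarz and gives `D`; the
  -- weight is chosen so that both parts integrate to a multiple of B.
  let D : E3 → ℝ := fun x => (2 * B)⁻¹ * (‖K x‖ ^ 2 + ∑ j, ‖H j x‖ ^ 2)
    + 2 * B * ((1 + ‖x‖ ^ 2)⁻¹) ^ 2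
  have hHs : Integrable fun x => ∑ j, ‖H j x‖ ^ 2 :=
    integrable_finsetSum _ fun j _ => integrable_norm_sq (H j)
  have hKH : Integrable fun x => ‖K x‖ ^ 2 + ∑ j, ‖H j x‖ ^ 2 := (integrable_norm_sq K).add hHs
  have hDi : Integrable D := (hKH.const_mul _).add (hWi.const_mul _)
  have hKD : ∀ᵐ x, ‖K x‖ ≤ D x := by
    filter_upwards [hHall] with x hx
    have hpi : 1 ≤ (2 * Real.pi) ^ 2 := by nlinarith [Real.pi_gt_three]
    have hj : ∀ j, x j ^ 2 * ‖K x‖ ≤ ‖H j x‖ := fun j => by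
      rw [← hx j, norm_smul, norm_neg, Real.norm_of_nonneg (by positivity), mul_pow]
      refine mul_le_mul_of_nonneg_right ?_ (norm_nonneg _)
      nlinarith [sq_nonneg (x j)]
    have hsum : (1 + ‖x‖ ^ 2) * ‖K x‖ ≤ ‖K x‖ + ∑ j, ‖H j x‖ := by
      rw [EuclideanSpace.norm_sq_eq, add_mul, one_mul, Finset.sum_mul]
      refine add_le_add le_rfl (Finset.sum_le_sum fun j _ => ?_)
      simpa using hj j
    set g := (1 + ‖x‖ ^ 2)⁻¹ with hg
    have hg0 : 0 < g := by positivity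
    have hKle : ‖K x‖ ≤ g * (‖K x‖ + ∑ j, ‖H j x‖) := by
      rw [hg, ← div_eq_inv_mul, le_div_iff₀ (by positivity)]
      linarith
    have hone : ∀ a : ℝ, g * a ≤ (2 * B)⁻¹ * a ^ 2 + B * g ^ 2 / 2 := fun a => by
      have e : (2 * B)⁻¹ * a ^ 2 + B * g ^ 2 / 2 - g * a = (a - B * g) ^ 2 * (2 * B)⁻¹ := by
        field_simp; ring
      have : 0 ≤ (a - B * g) ^ 2 * (2 * B)⁻¹ := by positivity
      linarith
    refine hKle.trans ?_
    have hK' := hone ‖K x‖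
    have hH' := fun j => hone ‖H j x‖
    simp only [D, Fin.sum_univ_three] at *
    linarith [hH' 0, hH' 1, hH' 2]
  have hKi : Integrable K :=
    hDi.mono' (Lp.aestronglyMeasurable K) hKD
  refine ⟨K, hKi, ?_, ?_⟩
  · have hKm : MemLp K 2 := Lp.memLp K
    have h := fourier_toLp_ae_eq hKi hKm
    rw [Lp.toLp_coeFn, fourier_fourierInv_eq] at h
    exact h.symm.trans m0.coeFn_toLp
  · refine (integral_mono_ae hKi.norm hDi hKD).trans ?_
    simp only [D]
    rw [integral_add (hKH.const_mul _) (hWi.const_mul _), integral_const_mul, integral_const_mul,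
      integral_add (integrable_norm_sq K) hHs,
      integral_finsetSum _ fun j _ => integrable_norm_sq (H j), ← hW]
    have b0 := integral_norm_sq_fourierInv_le h0 m0
    have b2 := Finset.sum_le_sum fun (j : Fin 3) (_ : j ∈ Finset.univ) =>
      integral_norm_sq_fourierInv_le (h2 j) (m2 j)
    rw [Finset.sum_const, Finset.card_univ, Fintype.card_fin, nsmul_eq_mul] at b2
    have b3 : (2 * B)⁻¹ * ((∫ x, ‖K x‖ ^ 2) + ∑ j, ∫ x, ‖H j x‖ ^ 2)
        ≤ (2 * B)⁻¹ * (4 * (B ^ 2 * W)) := by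
      refine mul_le_mul_of_nonneg_left ?_ (by positivity)
      push_cast at b2
      linarith
    have b4 : (2 * B)⁻¹ * (4 * (B ^ 2 * W)) = 2 * B * W := by field_simp; ring
    nlinarith

end Kernel

/-! ### Calculus of the partial derivatives `pd` -/

section PartialDerivatives

lemma pd_mul {f g : E3 → ℝ} (hf : Differentiable ℝ f) (hg : Differentiable ℝ g) (j : Fin 3) :
    pd j (fun x => f x * g x) = fun x => pd j f x * g x + f x * pd j g x := by
  funext x
  simp only [pd]
  rw [fderiv_fun_mul (hf x) (hg x)]
  simp
  ring

lemma pd_add {f g : E3 → ℝ} (hf : Differentiable ℝ f) (hg : Differentiable ℝ g) (j : Fin 3) :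
    pd j (fun x => f x + g x) = fun x => pd j f x + pd j g x := by
  funext x
  simp only [pd]
  rw [fderiv_fun_add (hf x) (hg x)]
  simp

lemma pd_const_mul {f : E3 → ℝ} (hf : Differentiable ℝ f) (c : ℝ) (j : Fin 3) :
    pd j (fun x => c * f x) = fun x => c * pd j f x := by
  funext x
  simp only [pd]
  rw [fderiv_const_mul (hf x)]
  simp

lemma pd_comp_smul {F : Type*} [NormedAddCommGroup F] [NormedSpace ℝ F] {f : E3 → F} (c : ℝ)
    (j : Fin 3) : pd j (fun x => f (c • x)) = fun x => c • pd j f (c • x) := by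
  funext x
  simp only [pd]
  rw [fderiv_comp_smul]
  simp

lemma contDiff_pd_infty {F : Type*} [NormedAddCommGroup F] [NormedSpace ℝ F] {f : E3 → F}
    (hf : ContDiff ℝ ∞ f) (j : Fin 3) : ContDiff ℝ ∞ (pd j f) := by
  unfold pd
  exact (hf.fderiv_right (m := ∞) (by simp)).clm_apply contDiff_const

lemma hasCompactSupport_pd {F : Type*} [NormedAddCommGroup F] [NormedSpace ℝ F] {f : E3 → F}
    (hf : HasCompactSupport f) (j : Fin 3) : HasCompactSupport (pd j f) := by
  unfold pd
  exact (hf.fderiv (𝕜 := ℝ)).comp_left (g := fun L : E3 →L[ℝ] F => L (EuclideanSpace.single j 1))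
    (by simp)

lemma pd_comm {f : E3 → ℝ} (hf : ContDiff ℝ ∞ f) (j k : Fin 3) :
    pd j (pd k f) = pd k (pd j f) := by
  funext x
  have hd : DifferentiableAt ℝ (fderiv ℝ f) x :=
    (hf.fderiv_right (m := 1) (by norm_cast)).differentiable one_ne_zero x
  have h : ∀ a b : Fin 3, pd a (pd b f) x = fderiv ℝ (fderiv ℝ f) x
      (EuclideanSpace.single a 1) (EuclideanSpace.single b 1) := fun a b => by
    unfold pd
    rw [fderiv_clm_apply hd (differentiableAt_const _)]
    simp
  rw [h, h]
  exact (hf.contDiffAt.isSymmSndFDerivAt (by simp; norm_cast)).eq _ _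

lemma exists_bound_of_hasCompactSupport {F : Type*} [NormedAddCommGroup F] {f : E3 → F}
    (hf : Continuous f) (hc : HasCompactSupport f) : ∃ C, ∀ x, ‖f x‖ ≤ C := by
  obtain ⟨C, hC⟩ := hc.exists_bound_of_continuous hf
  exact ⟨C, hC⟩

lemma pd_congr {F : Type*} [NormedAddCommGroup F] [NormedSpace ℝ F] {f g : E3 → F} {x : E3}
    (h : f =ᶠ[nhds x] g) (j : Fin 3) : pd j f =ᶠ[nhds x] pd j g := by
  filter_upwards [h.fderiv (𝕜 := ℝ)] with y hy
  simp only [pd, hy]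

end PartialDerivatives

/-! ### Weak identities tested on bounded smooth functions -/

section Truncation

lemma exists_smooth_cutoff : ∃ ρ : E3 → ℝ, ContDiff ℝ ∞ ρ ∧ HasCompactSupport ρ ∧
    ∀ x, ‖x‖ < 1 → ρ x = 1 := by
  let b : ContDiffBump (0 : E3) := ⟨1, 2, one_pos, one_lt_two⟩
  refine ⟨b, b.contDiff, b.hasCompactSupport, fun x hx => b.one_of_mem_closedBall ?_⟩
  simpa using hx.le

/-- Bounded smooth functions with bounded derivatives are limits of test functions. -/
lemma exists_truncation {e : E3 → ℝ} (he : ContDiff ℝ ∞ e) {M : ℝ} (h0 : ∀ x, ‖e x‖ ≤ M)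
    (h1 : ∀ j x, ‖pd j e x‖ ≤ M) (h2 : ∀ j x, ‖pd j (pd j e) x‖ ≤ M) :
    ∃ χ : ℕ → E3 → ℝ, ∃ C : ℝ, (∀ n, ContDiff ℝ ∞ (χ n)) ∧ (∀ n, HasCompactSupport (χ n)) ∧
      (∀ n x, ‖χ n x‖ ≤ C) ∧ (∀ n j x, ‖pd j (χ n) x‖ ≤ C) ∧
      (∀ n j x, ‖pd j (pd j (χ n)) x‖ ≤ C) ∧
      ∀ x, ∀ᶠ n in Filter.atTop, χ n =ᶠ[nhds x] e := by
  obtain ⟨ρ, hρ, hρc, hρ1⟩ := exists_smooth_cutoff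
  have hM : 0 ≤ M := (norm_nonneg _).trans (h0 0)
  obtain ⟨C0, hC0⟩ := exists_bound_of_hasCompactSupport hρ.continuous hρc
  have hb1 : ∀ j, ∃ C, ∀ x, ‖pd j ρ x‖ ≤ C := fun j =>
    exists_bound_of_hasCompactSupport (contDiff_pd_infty hρ j).continuous
      (hasCompactSupport_pd hρc j)
  have hb2 : ∀ j, ∃ C, ∀ x, ‖pd j (pd j ρ) x‖ ≤ C := fun j =>
    exists_bound_of_hasCompactSupport (contDiff_pd_infty (contDiff_pd_infty hρ j) j).continuous
      (hasCompactSupport_pd (hasCompactSupport_pd hρc j) j)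
  choose C1 hC1 using hb1
  choose C2 hC2 using hb2
  obtain ⟨D, hD0, hD1, hD2⟩ : ∃ D : ℝ, (∀ x, ‖ρ x‖ ≤ D) ∧ (∀ j x, ‖pd j ρ x‖ ≤ D) ∧
      (∀ j x, ‖pd j (pd j ρ) x‖ ≤ D) := by
    have n0 : 0 ≤ C0 := (norm_nonneg _).trans (hC0 0)
    have n1 : ∀ j, 0 ≤ C1 j := fun j => (norm_nonneg _).trans (hC1 j 0)
    have n2 : ∀ j, 0 ≤ C2 j := fun j => (norm_nonneg _).trans (hC2 j 0)
    have s1 : ∀ j, C1 j ≤ ∑ j, C1 j := fun j =>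
      Finset.single_le_sum (fun j _ => n1 j) (Finset.mem_univ j)
    have s2 : ∀ j, C2 j ≤ ∑ j, C2 j := fun j =>
      Finset.single_le_sum (fun j _ => n2 j) (Finset.mem_univ j)
    have t1 : 0 ≤ ∑ j, C1 j := Finset.sum_nonneg fun j _ => n1 j
    have t2 : 0 ≤ ∑ j, C2 j := Finset.sum_nonneg fun j _ => n2 j
    exact ⟨C0 + ∑ j, C1 j + ∑ j, C2 j, fun x => by linarith [hC0 x],
      fun j x => by linarith [hC1 j x, s1 j], fun j x => by linarith [hC2 j x, s2 j]⟩
  have hDn : 0 ≤ D := (norm_nonneg _).trans (hD0 0)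
  -- Cut-offs ρ(c n x) on growing balls: each derivative of the cut-off brings a factor c n ≤ 1, so
  -- the bounds are uniform in n, and near any fixed point the cut-off is eventually 1.
  let c : ℕ → ℝ := fun n => ((n : ℝ) + 1)⁻¹
  have hc0 : ∀ n, 0 < c n := fun n => by positivity
  have hc1 : ∀ n, c n ≤ 1 := fun n => inv_le_one_of_one_le₀ (by simp)
  have sm : ∀ {f : E3 → ℝ} (n : ℕ), ContDiff ℝ ∞ f → ContDiff ℝ ∞ fun x => f (c n • x) :=
    fun n hf => hf.comp (contDiff_const_smul (c n))
  have df : ∀ {f : E3 → ℝ}, ContDiff ℝ ∞ f → Differentiable ℝ f := fun hf =>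
    hf.differentiable (by simp)
  have e1 : ∀ n j, pd j (fun x => ρ (c n • x) * e x) = fun x =>
      c n * pd j ρ (c n • x) * e x + ρ (c n • x) * pd j e x := fun n j => by
    rw [pd_mul (df (sm n hρ)) (df he), pd_comp_smul]; rfl
  have e2 : ∀ n j, pd j (pd j (fun x => ρ (c n • x) * e x)) = fun x =>
      (c n * (c n * pd j (pd j ρ) (c n • x)) * e x + c n * pd j ρ (c n • x) * pd j e x) +
      (c n * pd j ρ (c n • x) * pd j e x + ρ (c n • x) * pd j (pd j e) x) := fun n j => by
    have d1 := df (sm n hρ)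
    have d2 := df (sm n (contDiff_pd_infty hρ j))
    have d3 := df he
    have d4 := df (contDiff_pd_infty he j)
    have d5 : Differentiable ℝ fun x => c n * pd j ρ (c n • x) := d2.const_mul _
    have d6 : Differentiable ℝ fun x => c n * pd j ρ (c n • x) * e x := d5.mul d3
    have d7 : Differentiable ℝ fun x => ρ (c n • x) * pd j e x := d1.mul d4
    rw [e1, pd_add d6 d7, pd_mul d5 d3, pd_mul d1 d4, pd_const_mul d2, pd_comp_smul, pd_comp_smul]
    rfl
  have hmul : ∀ {a b : ℝ}, ‖a‖ ≤ D → ‖b‖ ≤ M → ‖a * b‖ ≤ D * M := fun ha hb => by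
    rw [norm_mul]; exact mul_le_mul ha hb (norm_nonneg _) hDn
  have hcm : ∀ n {a : ℝ}, ‖a‖ ≤ D → ‖c n * a‖ ≤ D := fun n a ha => by
    rw [norm_mul, Real.norm_of_nonneg (hc0 n).le]
    exact (mul_le_of_le_one_left (norm_nonneg _) (hc1 n)).trans ha
  have hDM : 0 ≤ D * M := mul_nonneg hDn hM
  refine ⟨fun n x => ρ (c n • x) * e x, 4 * (D * M), fun n => (sm n hρ).mul he, fun n => ?_,
    fun n x => ?_, fun n j x => ?_, fun n j x => ?_, fun x => ?_⟩
  · exact (hρc.comp_smul (hc0 n).ne').mul_right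
  · linarith [hmul (hD0 (c n • x)) (h0 x)]
  · rw [e1]
    refine (norm_add_le _ _).trans ?_
    linarith [hmul (hcm n (hD1 j (c n • x))) (h0 x), hmul (hD0 (c n • x)) (h1 j x)]
  · rw [e2]
    refine (norm_add_le _ _).trans ((add_le_add (norm_add_le _ _) (norm_add_le _ _)).trans ?_)
    linarith [hmul (hcm n (hcm n (hD2 j (c n • x)))) (h0 x),
      hmul (hcm n (hD1 j (c n • x))) (h1 j x), hmul (hD0 (c n • x)) (h2 j x)]
  · obtain ⟨N, hN⟩ := exists_nat_gt ‖x‖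
    filter_upwards [Filter.eventually_ge_atTop N] with n hn
    have hopen : {y : E3 | ‖y‖ < N} ∈ nhds x :=
      (isOpen_lt continuous_norm continuous_const).mem_nhds hN
    filter_upwards [hopen] with y hy
    have : ‖c n • y‖ < 1 := by
      rw [norm_smul, Real.norm_of_nonneg (hc0 n).le, inv_mul_lt_iff₀ (by positivity)]
      have h3 : (N : ℝ) ≤ n := by exact_mod_cast hn
      have h4 : ‖y‖ < N := hy
      linarith
    rw [hρ1 _ this, one_mul]

lemma tendsto_integral_smul_of_eventually_eq {F : Type*} [NormedAddCommGroup F] [NormedSpace ℝ F]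
    {f : E3 → F} (hf : Integrable f) {χ : ℕ → E3 → ℝ} {e : E3 → ℝ} {C : ℝ}
    (hχ : ∀ n, Continuous (χ n)) (hb : ∀ n x, ‖χ n x‖ ≤ C)
    (h : ∀ x, ∀ᶠ n in Filter.atTop, χ n x = e x) :
    Filter.Tendsto (fun n => ∫ x, χ n x • f x) Filter.atTop (nhds (∫ x, e x • f x)) := by
  refine tendsto_integral_of_dominated_convergence (fun x => C * ‖f x‖)
    (fun n => (hχ n).aestronglyMeasurable.smul hf.1) (hf.norm.const_mul C)
    (fun n => Filter.Eventually.of_forall fun x => ?_) (Filter.Eventually.of_forall fun x => ?_)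
  · rw [norm_smul]
    exact mul_le_mul_of_nonneg_right (hb n x) (norm_nonneg _)
  · refine tendsto_const_nhds.congr' ?_
    filter_upwards [h x] with n hn
    rw [hn]

variable {F : Type*} [NormedAddCommGroup F] [NormedSpace ℝ F]

/-- Weak derivatives are tested on compactly supported functions only, while plane waves are merely
bounded with bounded derivatives. Integrability of `f` and `g` lets dominated convergence remove the
truncation. -/
lemma integral_pd_pd_smul_of_weak {f g : E3 → F} (hf : Integrable f) (hg : Integrable g)
    (j : Fin 3)
    (hw : ∀ χ : E3 → ℝ, ContDiff ℝ ∞ χ → HasCompactSupport χ →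
      ∫ x, pd j (pd j χ) x • f x = ∫ x, χ x • g x)
    {e : E3 → ℝ} (he : ContDiff ℝ ∞ e) {M : ℝ} (h0 : ∀ x, ‖e x‖ ≤ M)
    (h1 : ∀ j x, ‖pd j e x‖ ≤ M) (h2 : ∀ j x, ‖pd j (pd j e) x‖ ≤ M) :
    ∫ x, pd j (pd j e) x • f x = ∫ x, e x • g x := by
  obtain ⟨χ, C, hs, hc, b0, b1, b2, hlim⟩ := exists_truncation he h0 h1 h2
  refine tendsto_nhds_unique (tendsto_integral_smul_of_eventually_eq hf
    (fun n => (contDiff_pd_infty (contDiff_pd_infty (hs n) j) j).continuous)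
    (fun n => b2 n j) fun x => ?_) ?_
  · filter_upwards [hlim x] with n hn
    exact (pd_congr (pd_congr hn j) j).eq_of_nhds
  · simp_rw [fun n => hw (χ n) (hs n) (hc n)]
    refine tendsto_integral_smul_of_eventually_eq hg (fun n => (hs n).continuous) b0 fun x => ?_
    filter_upwards [hlim x] with n hn
    exact hn.eq_of_nhds

lemma integral_pd_smul_of_weak {f g : E3 → F} (hf : Integrable f) (hg : Integrable g)
    (j k : Fin 3)
    (hw : ∀ χ : E3 → ℝ, ContDiff ℝ ∞ χ → HasCompactSupport χ →
      ∫ x, pd j χ x • f x = ∫ x, pd k χ x • g x)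
    {e : E3 → ℝ} (he : ContDiff ℝ ∞ e) {M : ℝ} (h0 : ∀ x, ‖e x‖ ≤ M)
    (h1 : ∀ j x, ‖pd j e x‖ ≤ M) (h2 : ∀ j x, ‖pd j (pd j e) x‖ ≤ M) :
    ∫ x, pd j e x • f x = ∫ x, pd k e x • g x := by
  obtain ⟨χ, C, hs, hc, b0, b1, b2, hlim⟩ := exists_truncation he h0 h1 h2
  refine tendsto_nhds_unique (tendsto_integral_smul_of_eventually_eq hf
    (fun n => (contDiff_pd_infty (hs n) j).continuous) (fun n => b1 n j) fun x => ?_) ?_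
  · filter_upwards [hlim x] with n hn
    exact (pd_congr hn j).eq_of_nhds
  · simp_rw [fun n => hw (χ n) (hs n) (hc n)]
    refine tendsto_integral_smul_of_eventually_eq hg
      (fun n => (contDiff_pd_infty (hs n) k).continuous) (fun n => b1 n k) fun x => ?_
    filter_upwards [hlim x] with n hn
    exact (pd_congr hn k).eq_of_nhds

end Truncation

/-! ### Weak derivatives on the Fourier side -/

section Trigonometric

lemma pd_cos_inner (θ : E3) (j : Fin 3) :
    pd j (fun x : E3 => Real.cos (inner ℝ θ x)) = fun x => -θ j * Real.sin (inner ℝ θ x) := by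
  funext x
  have h : HasFDerivAt (fun y : E3 => (inner ℝ θ y : ℝ)) (innerSL ℝ θ) x :=
    (innerSL ℝ θ).hasFDerivAt
  rw [pd]
  erw [h.cos.fderiv]
  simp [EuclideanSpace.inner_single_right]
  ring

lemma pd_sin_inner (θ : E3) (j : Fin 3) :
    pd j (fun x : E3 => Real.sin (inner ℝ θ x)) = fun x => θ j * Real.cos (inner ℝ θ x) := by
  funext x
  have h : HasFDerivAt (fun y : E3 => (inner ℝ θ y : ℝ)) (innerSL ℝ θ) x :=
    (innerSL ℝ θ).hasFDerivAt
  rw [pd]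
  erw [h.sin.fderiv]
  simp [EuclideanSpace.inner_single_right]
  ring

lemma contDiff_cos_inner (θ : E3) : ContDiff ℝ ∞ fun x : E3 => Real.cos (inner ℝ θ x) := by
  exact (contDiff_const.inner ℝ contDiff_id).cos

lemma contDiff_sin_inner (θ : E3) : ContDiff ℝ ∞ fun x : E3 => Real.sin (inner ℝ θ x) := by
  exact (contDiff_const.inner ℝ contDiff_id).sin

lemma pd_pd_cos_inner (θ : E3) (j : Fin 3) :
    pd j (pd j (fun x : E3 => Real.cos (inner ℝ θ x))) =
      fun x => -θ j ^ 2 * Real.cos (inner ℝ θ x) := by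
  rw [pd_cos_inner, pd_const_mul ((contDiff_sin_inner θ).differentiable (by simp)), pd_sin_inner]
  funext x; ring

lemma pd_pd_sin_inner (θ : E3) (j : Fin 3) :
    pd j (pd j (fun x : E3 => Real.sin (inner ℝ θ x))) =
      fun x => -θ j ^ 2 * Real.sin (inner ℝ θ x) := by
  rw [pd_sin_inner, pd_const_mul ((contDiff_cos_inner θ).differentiable (by simp)), pd_cos_inner]
  funext x; ring

lemma trig_bounds (θ : E3) : ∃ M : ℝ, 1 ≤ M ∧ (∀ j s, |s| ≤ 1 → ‖θ j * s‖ ≤ M) ∧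
    (∀ j s, |s| ≤ 1 → ‖-θ j * s‖ ≤ M) ∧ ∀ j s, |s| ≤ 1 → ‖-θ j ^ 2 * s‖ ≤ M := by
  have hj : ∀ j, |θ j| ≤ ‖θ‖ := fun j => PiLp.norm_apply_le θ j
  have hn := norm_nonneg θ
  have key : ∀ a s : ℝ, |s| ≤ 1 → |a * s| ≤ |a| := fun a s hs => by
    rw [abs_mul]; exact mul_le_of_le_one_right (abs_nonneg _) hs
  refine ⟨1 + ‖θ‖ + ‖θ‖ ^ 2, by nlinarith, fun j s hs => ?_, fun j s hs => ?_, fun j s hs => ?_⟩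
  · rw [Real.norm_eq_abs]; nlinarith [key (θ j) s hs, hj j]
  · rw [Real.norm_eq_abs]
    have := key (-θ j) s hs
    rw [abs_neg] at this
    nlinarith [hj j]
  · rw [Real.norm_eq_abs]
    have := key (-θ j ^ 2) s hs
    rw [abs_neg, abs_pow] at this
    nlinarith [pow_le_pow_left₀ (abs_nonneg _) (hj j) 2]

variable {F : Type*} [NormedAddCommGroup F] [NormedSpace ℂ F]

/-- Test functions for weak derivatives are real-valued, so the exponential enters through its
cosine and sine parts. -/
lemma fourier_eq_cos_sin {f : E3 → F} (hf : Integrable f) (ξ : E3) :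
    𝓕 f ξ = (∫ x, Real.cos (inner ℝ ((2 * Real.pi) • ξ) x) • f x) -
      Complex.I • ∫ x, Real.sin (inner ℝ ((2 * Real.pi) • ξ) x) • f x := by
  have hc : Integrable fun x => Real.cos (inner ℝ ((2 * Real.pi) • ξ) x) • f x := by
    refine hf.mono ((contDiff_cos_inner _).continuous.aestronglyMeasurable.smul hf.1)
      (Filter.Eventually.of_forall fun x => ?_)
    rw [norm_smul]
    exact mul_le_of_le_one_left (norm_nonneg _) (Real.abs_cos_le_one _)
  have hs : Integrable fun x => Real.sin (inner ℝ ((2 * Real.pi) • ξ) x) • f x := by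
    refine hf.mono ((contDiff_sin_inner _).continuous.aestronglyMeasurable.smul hf.1)
      (Filter.Eventually.of_forall fun x => ?_)
    rw [norm_smul]
    exact mul_le_of_le_one_left (norm_nonneg _) (Real.abs_sin_le_one _)
  have hs' : Integrable fun x =>
      Complex.I • Real.sin (inner ℝ ((2 * Real.pi) • ξ) x) • f x := hs.smul Complex.I
  rw [← integral_smul, ← integral_sub hc hs', Real.fourier_eq']
  refine integral_congr_ae (Filter.Eventually.of_forall fun x => ?_)
  have e : Complex.exp ((↑(-2 * Real.pi * inner ℝ x ξ) : ℂ) * Complex.I) =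
      (Real.cos (inner ℝ ((2 * Real.pi) • ξ) x) : ℂ) -
        Complex.I * (Real.sin (inner ℝ ((2 * Real.pi) • ξ) x) : ℂ) := by
    rw [Complex.exp_mul_I, real_inner_smul_left, real_inner_comm, neg_mul, neg_mul]
    push_cast
    rw [Complex.cos_neg, Complex.sin_neg]
    ring
  simp only [e, sub_smul, mul_smul, Complex.coe_smul]

/-- The test functions cos(θ·x) and sin(θ·x) with θ = 2πξ are eigenfunctions of ∂_j² with eigenvalue
-θ_j². -/
lemma fourier_of_weak_pd_pd {f g : E3 → F} (hf : Integrable f) (hg : Integrable g)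
    (j : Fin 3)
    (hw : ∀ χ : E3 → ℝ, ContDiff ℝ ∞ χ → HasCompactSupport χ →
      ∫ x, pd j (pd j χ) x • f x = ∫ x, χ x • g x) (ξ : E3) :
    𝓕 g ξ = -((2 * Real.pi) * ξ j) ^ 2 • 𝓕 f ξ := by
  set θ : E3 := (2 * Real.pi) • ξ with hθ
  have hθj : θ j = 2 * Real.pi * ξ j := by simp [hθ]
  obtain ⟨M, hM, m1, m1', m2⟩ := trig_bounds θ
  have c := integral_pd_pd_smul_of_weak hf hg j hw (contDiff_cos_inner θ) (M := M)
    (fun x => (Real.abs_cos_le_one _).trans hM)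
    (fun j x => by rw [pd_cos_inner]; exact m1' j _ (Real.abs_sin_le_one _))
    (fun j x => by rw [pd_pd_cos_inner]; exact m2 j _ (Real.abs_cos_le_one _))
  have s := integral_pd_pd_smul_of_weak hf hg j hw (contDiff_sin_inner θ) (M := M)
    (fun x => (Real.abs_sin_le_one _).trans hM)
    (fun j x => by rw [pd_sin_inner]; exact m1 j _ (Real.abs_cos_le_one _))
    (fun j x => by rw [pd_pd_sin_inner]; exact m2 j _ (Real.abs_sin_le_one _))
  rw [pd_pd_cos_inner] at c
  rw [pd_pd_sin_inner] at s
  simp only [mul_smul, integral_smul] at c s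
  rw [fourier_eq_cos_sin hf, fourier_eq_cos_sin hg, ← c, ← s, smul_sub, hθj, smul_comm Complex.I]

/-- Used for the compatibility ∂_l Gʲᵏ = ∂_k Gʲˡ. It avoids transforming the potential ψ, which is
only locally integrable. -/
lemma fourier_of_weak_pd {f g : E3 → F} (hf : Integrable f) (hg : Integrable g)
    (j k : Fin 3)
    (hw : ∀ χ : E3 → ℝ, ContDiff ℝ ∞ χ → HasCompactSupport χ →
      ∫ x, pd j χ x • f x = ∫ x, pd k χ x • g x) (ξ : E3) :
    ξ j • 𝓕 f ξ = ξ k • 𝓕 g ξ := by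
  set θ : E3 := (2 * Real.pi) • ξ with hθ
  have hθj : ∀ j, θ j = 2 * Real.pi * ξ j := fun j => by simp [hθ]
  obtain ⟨M, hM, m1, m1', m2⟩ := trig_bounds θ
  have c := integral_pd_smul_of_weak hf hg j k hw (contDiff_cos_inner θ) (M := M)
    (fun x => (Real.abs_cos_le_one _).trans hM)
    (fun j x => by rw [pd_cos_inner]; exact m1' j _ (Real.abs_sin_le_one _))
    (fun j x => by rw [pd_pd_cos_inner]; exact m2 j _ (Real.abs_cos_le_one _))
  have s := integral_pd_smul_of_weak hf hg j k hw (contDiff_sin_inner θ) (M := M)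
    (fun x => (Real.abs_sin_le_one _).trans hM)
    (fun j x => by rw [pd_sin_inner]; exact m1 j _ (Real.abs_cos_le_one _))
    (fun j x => by rw [pd_pd_sin_inner]; exact m2 j _ (Real.abs_sin_le_one _))
  rw [pd_cos_inner, pd_cos_inner] at c
  rw [pd_sin_inner, pd_sin_inner] at s
  simp only [mul_smul, integral_smul, neg_smul, integral_neg, neg_inj] at c s
  have h2 : (2 * Real.pi) • (ξ j • 𝓕 f ξ) = (2 * Real.pi) • (ξ k • 𝓕 g ξ) := by
    rw [smul_smul, smul_smul, ← hθj, ← hθj, fourier_eq_cos_sin hf, fourier_eq_cos_sin hg,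
      smul_sub, smul_sub, smul_comm (θ j) Complex.I, smul_comm (θ k) Complex.I, c, s]
  exact smul_right_injective F (by positivity : (2 * Real.pi) ≠ 0) h2

end Trigonometric

/-! ### The space W^{2,1} and the operator 1 - Δ -/

section Sobolev

variable {F : Type*} [NormedAddCommGroup F] [NormedSpace ℝ F]

lemma multiPd_single_two (χ : E3 → F) (j : Fin 3) :
    multiPd (Pi.single j 2) χ = pd j (pd j χ) := by
  fin_cases j <;> simp [multiPd]

lemma multiPd_single_one (χ : E3 → F) (j : Fin 3) :
    multiPd (Pi.single j 1) χ = pd j χ := by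
  fin_cases j <;> simp [multiPd]

lemma IsWeakDeriv.ae_unique {α : Fin 3 → ℕ} {f g g' : E3 → F} [CompleteSpace F]
    (h : IsWeakDeriv α f g) (h' : IsWeakDeriv α f g') : g =ᵐ[volume] g' := by
  refine ae_eq_of_integral_contDiff_smul_eq h.2.1 h'.2.1 fun χ hχ hc => ?_
  have e := (h.2.2 χ hχ hc).symm.trans (h'.2.2 χ hχ hc)
  exact smul_right_injective F (pow_ne_zero _ (by norm_num : (-1 : ℝ) ≠ 0)) e

lemma MemW1.isWeakDeriv_weakDeriv {m : ℕ} {f : E3 → F} (hf : MemW1 m f) {α : Fin 3 → ℕ}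
    (hα : ∑ k, α k ≤ m) : IsWeakDeriv α f (weakDeriv α f) := by
  have h : ∃ g, IsWeakDeriv α f g := (hf α hα).imp fun g hg => hg.1
  rw [weakDeriv, dif_pos h]
  exact h.choose_spec

/-- `weakDeriv` is an arbitrary choice; integrability passes to it from the witness in `MemW1` by
uniqueness of weak derivatives. -/
lemma MemW1.integrable_weakDeriv [CompleteSpace F] {m : ℕ} {f : E3 → F} (hf : MemW1 m f)
    {α : Fin 3 → ℕ} (hα : ∑ k, α k ≤ m) : Integrable (weakDeriv α f) := by
  obtain ⟨g, hg, hi⟩ := hf α hα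
  exact hi.congr (hg.ae_unique (hf.isWeakDeriv_weakDeriv hα))

lemma MemW1.weakDeriv_zero_ae_eq [CompleteSpace F] {m : ℕ} {f : E3 → F} (hf : MemW1 m f) :
    f =ᵐ[volume] weakDeriv 0 f := by
  have h := hf.isWeakDeriv_weakDeriv (α := 0) (by simp)
  refine ae_eq_of_integral_contDiff_smul_eq h.1 h.2.1 fun χ hχ hc => ?_
  simpa [multiPd] using h.2.2 χ hχ hc

lemma MemW1.integrable [CompleteSpace F] {m : ℕ} {f : E3 → F} (hf : MemW1 m f) :
    Integrable f :=
  (hf.integrable_weakDeriv (α := 0) (by simp)).congr hf.weakDeriv_zero_ae_eq.symm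

/-- Only the terms needed for (1 - Δ)f are kept: order zero and the pure second derivatives. -/
lemma weakDeriv_le_normW1 (f : E3 → F) :
    (∫ x, ‖weakDeriv 0 f x‖) + ∑ j, ∫ x, ‖weakDeriv (Pi.single j 2) f x‖ ≤ normW1 2 f := by
  have h0 : ∀ α : Fin 3 → ℕ, 0 ≤ ∫ x, ‖weakDeriv α f x‖ := fun α =>
    integral_nonneg fun x => norm_nonneg _
  have hs : ∀ n, 0 ≤ ∑ α ∈ Finset.piAntidiag (Finset.univ : Finset (Fin 3)) n,
      ∫ x, ‖weakDeriv α f x‖ := fun n => Finset.sum_nonneg fun α _ => h0 α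
  have h2 : ∑ j : Fin 3, ∫ x, ‖weakDeriv (Pi.single j 2) f x‖ ≤
      ∑ α ∈ Finset.piAntidiag (Finset.univ : Finset (Fin 3)) 2, ∫ x, ‖weakDeriv α f x‖ := by
    have hinj : Function.Injective fun j : Fin 3 => (Pi.single j 2 : Fin 3 → ℕ) := by
      intro i j hij
      by_contra hne
      have := congrFun hij i
      simp [hne] at this
    rw [← Finset.sum_image (s := Finset.univ) (g := fun j : Fin 3 => (Pi.single j 2 : Fin 3 → ℕ))
      (f := fun α => ∫ x, ‖weakDeriv α f x‖) hinj.injOn]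
    refine Finset.sum_le_sum_of_subset_of_nonneg (fun α hα => ?_) fun α _ _ => h0 α
    obtain ⟨j, -, rfl⟩ := Finset.mem_image.1 hα
    simp
  have h1 : (∫ x, ‖weakDeriv 0 f x‖) ≤
      ∑ α ∈ Finset.piAntidiag (Finset.univ : Finset (Fin 3)) 0, ∫ x, ‖weakDeriv α f x‖ :=
    Finset.single_le_sum (f := fun α => ∫ x, ‖weakDeriv α f x‖) (fun α _ => h0 α) (by simp)
  rw [normW1, Finset.sum_range_succ, Finset.sum_range_succ, Finset.sum_range_one]
  linarith [hs 1]

lemma integrable_exp_smul {F : Type*} [NormedAddCommGroup F] [NormedSpace ℂ F] {f : E3 → F}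
    (hf : Integrable f) (ξ : E3) : Integrable fun x =>
      Complex.exp ((↑(-2 * Real.pi * inner ℝ x ξ) : ℂ) * Complex.I) • f x := by
  refine hf.mono (((by fun_prop : Continuous fun x : E3 =>
    Complex.exp ((↑(-2 * Real.pi * inner ℝ x ξ) : ℂ) * Complex.I)).aestronglyMeasurable).smul
    hf.1) (Filter.Eventually.of_forall fun x => ?_)
  rw [norm_smul, Complex.norm_exp_ofReal_mul_I, one_mul]

lemma fourier_finset_sum {ι F : Type*} [NormedAddCommGroup F] [NormedSpace ℂ F] (s : Finset ι)
    {f : ι → E3 → F} (hf : ∀ i ∈ s, Integrable (f i)) (ξ : E3) :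
    𝓕 (fun x => ∑ i ∈ s, f i x) ξ = ∑ i ∈ s, 𝓕 (f i) ξ := by
  simp only [Real.fourier_eq', Finset.smul_sum]
  exact integral_finsetSum _ fun i hi => integrable_exp_smul (hf i hi) ξ

/-- For `f ∈ W^{2,1}` the function `(1 - Δ) f` is integrable, and its Fourier transform is
`(1 + |2πξ|²) f̂`. -/
lemma MemW1.exists_bessel {F : Type*} [NormedAddCommGroup F] [NormedSpace ℂ F] [CompleteSpace F]
    {f : E3 → F} (hf : MemW1 2 f) : ∃ V : E3 → F, Integrable V ∧
      (∀ ξ, 𝓕 V ξ = (1 + ‖(2 * Real.pi) • ξ‖ ^ 2) • 𝓕 f ξ) ∧ ∫ x, ‖V x‖ ≤ normW1 2 f := by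
  have hs : ∀ j : Fin 3, ∑ k, (Pi.single j 2 : Fin 3 → ℕ) k ≤ 2 := fun j => by simp
  let g : Fin 3 → E3 → F := fun j => weakDeriv (Pi.single j 2) f
  have hg : ∀ j, Integrable (g j) := fun j => hf.integrable_weakDeriv (hs j)
  have hG : Integrable fun x => ∑ j, g j x := integrable_finsetSum _ fun j _ => hg j
  have hF : ∀ j ξ, 𝓕 (g j) ξ = -((2 * Real.pi) * ξ j) ^ 2 • 𝓕 f ξ := fun j ξ => by
    refine fourier_of_weak_pd_pd hf.integrable (hg j) j (fun χ hχ hc => ?_) ξ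
    have := (hf.isWeakDeriv_weakDeriv (hs j)).2.2 χ hχ hc
    simpa [multiPd_single_two] using this
  refine ⟨fun x => f x - ∑ j, g j x, hf.integrable.sub hG, fun ξ => ?_, ?_⟩
  · have e : 𝓕 (fun x => f x - ∑ j, g j x) ξ = 𝓕 f ξ - ∑ j, 𝓕 (g j) ξ := by
      rw [← fourier_finset_sum _ fun j _ => hg j]
      simp only [Real.fourier_eq', smul_sub]
      exact integral_sub (integrable_exp_smul hf.integrable ξ) (integrable_exp_smul hG ξ)
    rw [e]
    simp_rw [hF, neg_smul, Finset.sum_neg_distrib, ← Finset.sum_smul]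
    rw [sub_neg_eq_add, add_smul, one_smul, EuclideanSpace.norm_sq_eq]
    simp [mul_pow]
  · have hfw : ∫ x, ‖f x‖ = ∫ x, ‖weakDeriv 0 f x‖ := by
      refine integral_congr_ae ?_
      filter_upwards [hf.weakDeriv_zero_ae_eq] with x hx
      rw [hx]
    have hsn : Integrable fun x => ∑ j, ‖g j x‖ := integrable_finsetSum _ fun j _ => (hg j).norm
    refine le_trans ?_ (weakDeriv_le_normW1 f)
    rw [← hfw, ← integral_finsetSum _ fun j _ => (hg j).norm,
      ← integral_add hf.integrable.norm hsn]
    refine integral_mono (hf.integrable.sub hG).norm (hf.integrable.norm.add hsn) fun x => ?_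
    exact (norm_sub_le _ _).trans (add_le_add le_rfl (norm_sum_le _ _))

lemma fourier_clm_apply {F G : Type*} [NormedAddCommGroup F] [NormedSpace ℂ F] [CompleteSpace F]
    [NormedAddCommGroup G] [NormedSpace ℂ G] [CompleteSpace G] (L : F →L[ℂ] G) {f : E3 → F}
    (hf : Integrable f) (ξ : E3) : 𝓕 (fun x => L (f x)) ξ = L (𝓕 f ξ) := by
  simp only [Real.fourier_eq']
  rw [← L.integral_comp_comm (integrable_exp_smul hf ξ)]
  simp

/-- The transform of `f` is (1 + |2πξ|²)⁻¹ times the bounded transform of (1 - Δ)f, hence square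
integrable in dimension three. -/
lemma memLp_two_of_memW1 {F : Type*} [NormedAddCommGroup F] [InnerProductSpace ℂ F]
    [CompleteSpace F] {f : E3 → F} (hf : MemW1 2 f) : MemLp f 2 := by
  refine memLp_two_of_memLp_fourier hf.integrable ?_
  obtain ⟨V, hV, hVF, -⟩ := hf.exists_bessel
  refine memLp_two_of_decay (continuous_fourier_of_integrable hf.integrable)
    (B := ∫ x, ‖V x‖) fun ξ => ?_
  have h1 : ‖𝓕 V ξ‖ ≤ ∫ x, ‖V x‖ := VectorFourier.norm_fourierIntegral_le_integral_norm _ _ _ _ _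
  rw [hVF, norm_smul, Real.norm_of_nonneg (by positivity)] at h1
  rw [← div_eq_mul_inv, le_div_iff₀ (by positivity)]
  refine le_trans ?_ h1
  rw [mul_comm]
  refine mul_le_mul_of_nonneg_right ?_ (norm_nonneg _)
  rw [norm_smul, mul_pow, Real.norm_of_nonneg (by positivity)]
  nlinarith [Real.pi_gt_three, sq_nonneg ‖ξ‖, mul_nonneg (by nlinarith [Real.pi_gt_three] :
    0 ≤ (2 * Real.pi) ^ 2 - 1) (sq_nonneg ‖ξ‖)]

end Sobolev

/-! ### The constraints on the Fourier side -/

section Constraints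

lemma phi_eq (u : State) : phi u = EuclideanSpace.proj (𝕜 := ℂ) (Sum.inl ()) u := rfl

lemma tens_eq (u : State) (j k : Fin 3) :
    tens u j k = EuclideanSpace.proj (𝕜 := ℂ) (Sum.inr (Sum.inr (j, k))) u := rfl

/-- The gradient constraint in Fourier variables: `ξ_l Ĝʲᵏ = ξ_k Ĝʲˡ`. -/
lemma fourier_tens_of_isGradient {U : E3 → State} (hU : Integrable U)
    (hG : IsGradient fun x => tens (U x)) (j k l : Fin 3) (ξ : E3) :
    (ξ l : ℂ) * tens (𝓕 U ξ) j k = ξ k * tens (𝓕 U ξ) j l := by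
  obtain ⟨ψ, hψ⟩ := hG
  have hi : ∀ k, Integrable fun x => tens (U x) j k := fun k =>
    (EuclideanSpace.proj (𝕜 := ℂ) (Sum.inr (Sum.inr (j, k)) : Comp)).integrable_comp hU
  have hF : ∀ k, 𝓕 (fun x => tens (U x) j k) ξ = tens (𝓕 U ξ) j k := fun k => by
    simp only [tens_eq]
    exact fourier_clm_apply _ hU ξ
  have h := fourier_of_weak_pd (hi k) (hi l) l k (fun χ hχ hc => ?_) ξ
  · rw [hF, hF] at h
    simpa using h
  -- The function ∂_k∂_lχ is tested against ψʲ in two ways, as a k-derivative of ∂_lχ and as an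
  -- l-derivative of ∂_kχ; ψ then drops out.
  · have h1 := (hψ j k).2.2 (pd l χ) (contDiff_pd_infty hχ l) (hasCompactSupport_pd hc l)
    have h2 := (hψ j l).2.2 (pd k χ) (contDiff_pd_infty hχ k) (hasCompactSupport_pd hc k)
    rw [multiPd_single_one] at h1 h2
    rw [pd_comm hχ] at h1
    rw [h1] at h2
    simpa using h2

/-- The trace constraint in Fourier variables. -/
lemma fourier_trace {U : E3 → State} (hU : Integrable U)
    (hT : ∀ᵐ x, phi (U x) + ∑ k, tens (U x) k k = 0) (ξ : E3) :
    phi (𝓕 U ξ) + ∑ k, tens (𝓕 U ξ) k k = 0 := by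
  let L : State →L[ℂ] ℂ := EuclideanSpace.proj (𝕜 := ℂ) (Sum.inl () : Comp) +
    ∑ k, EuclideanSpace.proj (𝕜 := ℂ) (Sum.inr (Sum.inr (k, k)) : Comp)
  have hL : ∀ u, L u = phi u + ∑ k, tens u k k := fun u => by
    simp [L, phi_eq, tens_eq, sum_apply]
  rw [← hL, ← fourier_clm_apply L hU, Real.fourier_eq']
  refine integral_eq_zero_of_ae ?_
  filter_upwards [hT] with x hx
  simp [hL, hx]

end Constraints

/-! ### Lyapunov estimate for the damped oscillator -/

section DampedOscillator

set_option maxHeartbeats 800000 in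
/-- Exponential decay for `b'' + A z b' + B z b = 0` with `z` in a thin complex sector around
`[ρ₀², ∞)`, uniformly in `z`. -/
lemma exists_damped_decay {A B ρ₀ : ℝ} (hA : 0 < A) (hB : 0 < B) (hρ₀ : 0 < ρ₀) :
    ∃ ε > 0, ∃ C ≥ 1, ∃ c > 0, ∀ ρ ≥ ρ₀, ∀ z : ℂ, ‖z - (ρ ^ 2 : ℝ)‖ ≤ ε * ρ ^ 2 →
      ∀ b w : ℝ → ℂ, (∀ t, HasDerivAt b (w t) t) →
      (∀ t, HasDerivAt w (-(A * z * w t) - B * z * b t) t) →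
      ∀ t ≥ 0, ‖w t‖ ≤ C * Real.exp (-c * t) * (‖w 0‖ + ρ * ‖b 0‖) ∧
        ρ * ‖b t‖ ≤ C * Real.exp (-c * t) * (‖w 0‖ + ρ * ‖b 0‖) := by
  set r₀ := ρ₀ ^ 2 with hr₀
  have hr₀p : 0 < r₀ := by positivity
  -- Weight of the cross term in the functional `E`. It gives 2κ ≤ A r for all r ≥ r₀, so the term
  -- 2κ‖w‖² in E' uses at most half of the viscous damping, and 2κ² ≤ κ A r, so `E` stays coercive.
  set κ := A * r₀ / 2 with hκ
  have hκp : 0 < κ := by positivity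
  set m := min A (2 * κ * B) with hm
  have hmp : 0 < m := lt_min hA (by positivity)
  have hmA : m ≤ A := min_le_left _ _
  have hmB : m ≤ 2 * κ * B := min_le_right _ _
  set S := 2 * A + 2 * B + κ * A + 2 * κ * B with hS
  have hSp : 0 < S := by positivity
  set m' := m / 2 * min r₀ 1 with hm'
  have hm'p : 0 < m' := by positivity
  set S₂ := 1 + B + κ + κ / r₀ + κ * A with hS₂
  have hS₂p : 0 < S₂ := by positivity
  set s₁ := min (1 / 2) B with hs₁
  have hs₁p : 0 < s₁ := lt_min (by norm_num) hB
  set C := max 1 (S₂ / s₁) with hC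
  have hC1 : 1 ≤ C := le_max_left _ _
  set c := m' / S₂ with hc
  have hcp : 0 < c := by positivity
  -- The sector is so thin that the error from z ≠ ρ² costs at most half of the dissipation m r
  -- (‖w‖² + ‖b‖²). The rate is halved because `E` is quadratic in the solution.
  refine ⟨m / (2 * S), by positivity, C, hC1, c / 2, by positivity, ?_⟩
  intro ρ hρ z hz b w hb hw
  have hρp : 0 < ρ := hρ₀.trans_le hρ
  set r := ρ ^ 2 with hr
  have hr0 : r₀ ≤ r := pow_le_pow_left₀ hρ₀.le hρ 2
  have hrp : 0 < r := by positivity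
  -- The energy for z = r alone does not dissipate `b`. The κ-term supplies -2κBr‖b‖², and its part
  -- A r‖b‖² cancels the mixed products ⟨b, w⟩ in the derivative.
  let E : ℝ → ℝ := fun t => ‖w t‖ ^ 2 + B * r * ‖b t‖ ^ 2 +
    κ * (2 * inner ℝ (b t) (w t) + A * r * ‖b t‖ ^ 2)
  let w' : ℝ → ℂ := fun t => -(A * z * w t) - B * z * b t
  let E' : ℝ → ℝ := fun t => 2 * inner ℝ (w t) (w' t) + B * r * (2 * inner ℝ (b t) (w t)) +
    κ * (2 * (inner ℝ (b t) (w' t) + inner ℝ (w t) (w t)) + A * r * (2 * inner ℝ (b t) (w t)))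
  have hE : ∀ t, HasDerivAt E (E' t) t := fun t =>
    (((hw t).norm_sq).add (((hb t).norm_sq).const_mul (B * r))).add
      (((((hb t).inner ℝ (hw t)).const_mul 2).add
        (((hb t).norm_sq).const_mul (A * r))).const_mul κ)
  have hWY : ∀ t, |inner ℝ (b t) (w t)| ≤ ‖b t‖ * ‖w t‖ := fun t => abs_real_inner_le_norm _ _
  have hupper : ∀ t, E t ≤ S₂ * (‖w t‖ ^ 2 + r * ‖b t‖ ^ 2) := fun t => by
    have h1 := (abs_le.1 (hWY t)).2
    have h2 : ‖b t‖ ^ 2 ≤ r / r₀ * ‖b t‖ ^ 2 :=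
      le_mul_of_one_le_left (sq_nonneg _) ((one_le_div hr₀p).2 hr0)
    have h3 : 2 * (‖b t‖ * ‖w t‖) ≤ ‖w t‖ ^ 2 + ‖b t‖ ^ 2 := by
      linarith [two_mul_le_add_sq ‖w t‖ ‖b t‖]
    have h4 : κ * (2 * inner ℝ (b t) (w t)) ≤ κ * (‖w t‖ ^ 2 + r / r₀ * ‖b t‖ ^ 2) :=
      mul_le_mul_of_nonneg_left (by linarith) hκp.le
    have h5 : 0 ≤ (B + κ / r₀ + κ * A) * ‖w t‖ ^ 2 + (1 + κ) * (r * ‖b t‖ ^ 2) := by positivity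
    have e : S₂ * (‖w t‖ ^ 2 + r * ‖b t‖ ^ 2) = ‖w t‖ ^ 2 + B * r * ‖b t‖ ^ 2 +
      (κ * (‖w t‖ ^ 2 + r / r₀ * ‖b t‖ ^ 2) + κ * (A * r * ‖b t‖ ^ 2)) +
      ((B + κ / r₀ + κ * A) * ‖w t‖ ^ 2 + (1 + κ) * (r * ‖b t‖ ^ 2)) := by
      rw [hS₂]; field_simp; ring
    rw [e]
    simp only [E]
    linarith
  have hlower : ∀ t, s₁ * (‖w t‖ ^ 2 + r * ‖b t‖ ^ 2) ≤ E t := fun t => by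
    have h1 := (abs_le.1 (hWY t)).1
    have h2 : 2 * κ * (‖b t‖ * ‖w t‖) ≤ 1 / 2 * ‖w t‖ ^ 2 + 2 * κ ^ 2 * ‖b t‖ ^ 2 := by
      linarith [two_mul_le_add_sq ‖w t‖ (2 * κ * ‖b t‖)]
    have h3 : 2 * κ ^ 2 * ‖b t‖ ^ 2 ≤ κ * (A * r * ‖b t‖ ^ 2) := by
      have : 2 * κ ^ 2 = κ * (A * r₀) := by rw [hκ]; ring
      rw [this]
      have := mul_le_mul_of_nonneg_left hr0 (by positivity : 0 ≤ κ * A * ‖b t‖ ^ 2)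
      linarith
    have h4 : κ * (2 * inner ℝ (b t) (w t)) ≥ -(2 * κ * (‖b t‖ * ‖w t‖)) := by
      have := mul_le_mul_of_nonneg_left h1 (by positivity : 0 ≤ 2 * κ)
      linarith
    have h5 : s₁ * ‖w t‖ ^ 2 ≤ 1 / 2 * ‖w t‖ ^ 2 :=
      mul_le_mul_of_nonneg_right (min_le_left _ _) (sq_nonneg _)
    have h6 : s₁ * (r * ‖b t‖ ^ 2) ≤ B * (r * ‖b t‖ ^ 2) :=
      mul_le_mul_of_nonneg_right (min_le_right _ _) (by positivity)
    simp only [E]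
    linarith
  have hdecay : ∀ t, E' t ≤ -c * E t := fun t => by
    set W := ‖w t‖ with hW
    set Y := ‖b t‖ with hY
    have hW0 : 0 ≤ W := norm_nonneg _
    have hY0 : 0 ≤ Y := norm_nonneg _
    -- The complex coefficient z is treated as a perturbation of the real number r.
    let q : ℂ := (z - (r : ℝ)) * (A * w t + B * b t)
    have hw' : w' t = -((A * r) • w t) - (B * r) • b t - q := by
      simp only [w', q, Complex.real_smul]
      push_cast
      ring
    have hq : ‖q‖ ≤ m / (2 * S) * r * (A * W + B * Y) := by
      rw [norm_mul]
      refine mul_le_mul hz ((norm_add_le _ _).trans_eq ?_) (norm_nonneg _) (by positivity)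
      rw [norm_mul, norm_mul, Complex.norm_of_nonneg hA.le, Complex.norm_of_nonneg hB.le]
    have i1 : inner ℝ (w t) (w' t) = -(A * r) * W ^ 2 - B * r * inner ℝ (b t) (w t)
        - inner ℝ (w t) q := by
      rw [hw', inner_sub_right, inner_sub_right, inner_neg_right, inner_smul_right,
        inner_smul_right, real_inner_self_eq_norm_sq, real_inner_comm (w t) (b t)]
      simp [hW]
    have i2 : inner ℝ (b t) (w' t) = -(A * r) * inner ℝ (b t) (w t) - B * r * Y ^ 2
        - inner ℝ (b t) q := by
      rw [hw', inner_sub_right, inner_sub_right, inner_neg_right, inner_smul_right,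
        inner_smul_right, real_inner_self_eq_norm_sq]
      simp [hY]
    have hE'eq : E' t = -2 * (A * r) * W ^ 2 + 2 * κ * W ^ 2 - 2 * κ * B * r * Y ^ 2
        - 2 * inner ℝ (w t) q - 2 * κ * inner ℝ (b t) q := by
      simp only [E']
      rw [i1, i2, real_inner_self_eq_norm_sq]
      ring
    have j1 : -(W * ‖q‖) ≤ inner ℝ (w t) q := (abs_le.1 (abs_real_inner_le_norm _ _)).1
    have j2 : -(Y * ‖q‖) ≤ inner ℝ (b t) q := (abs_le.1 (abs_real_inner_le_norm _ _)).1
    have j2' := mul_le_mul_of_nonneg_left j2 hκp.le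
    have j3 : (W + κ * Y) * ‖q‖ ≤ (W + κ * Y) * (m / (2 * S) * r * (A * W + B * Y)) :=
      mul_le_mul_of_nonneg_left hq (by positivity)
    have j4 : 2 * ((W + κ * Y) * (A * W + B * Y)) ≤ S * (W ^ 2 + Y ^ 2) := by
      have t1 := mul_nonneg (by positivity : 0 ≤ B + κ * A) (sq_nonneg (W - Y))
      have t2 : 0 ≤ (B + 2 * κ * B) * W ^ 2 + (2 * A + B) * Y ^ 2 := by positivity
      have e : S * (W ^ 2 + Y ^ 2) = 2 * ((W + κ * Y) * (A * W + B * Y)) +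
        (B + κ * A) * (W - Y) ^ 2 + ((B + 2 * κ * B) * W ^ 2 + (2 * A + B) * Y ^ 2) := by
        rw [hS]; ring
      linarith
    have j5 : 2 * ((W + κ * Y) * (m / (2 * S) * r * (A * W + B * Y))) ≤
        r * (m / 2 * (W ^ 2 + Y ^ 2)) := by
      have := mul_le_mul_of_nonneg_left j4 (by positivity : 0 ≤ m / (2 * S) * r)
      have e : m / (2 * S) * r * (S * (W ^ 2 + Y ^ 2)) = r * (m / 2 * (W ^ 2 + Y ^ 2)) := by
        field_simp
      rw [e] at this
      linarith
    have j6 : 2 * κ * W ^ 2 ≤ A * r * W ^ 2 := by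
      refine mul_le_mul_of_nonneg_right ?_ (sq_nonneg _)
      have := mul_le_mul_of_nonneg_left hr0 hA.le
      rw [hκ]; linarith
    have j7 : r * (m * W ^ 2) ≤ A * r * W ^ 2 := by
      have := mul_le_mul_of_nonneg_right hmA (by positivity : 0 ≤ r * W ^ 2)
      linarith
    have j8 : r * (m * Y ^ 2) ≤ 2 * κ * B * r * Y ^ 2 := by
      have := mul_le_mul_of_nonneg_right hmB (by positivity : 0 ≤ r * Y ^ 2)
      linarith
    have k1 : E' t ≤ -(r * (m / 2 * (W ^ 2 + Y ^ 2))) := by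
      rw [hE'eq]
      linarith
    -- The dissipation controls r‖b‖² with no spare power of r, which is why the rate stays bounded
    -- as ρ grows.
    have k2 : m' * (W ^ 2 + r * Y ^ 2) ≤ r * (m / 2 * (W ^ 2 + Y ^ 2)) := by
      have t1 : min r₀ 1 * W ^ 2 ≤ r * W ^ 2 :=
        mul_le_mul_of_nonneg_right ((min_le_left _ _).trans hr0) (sq_nonneg _)
      have t2 : min r₀ 1 * (r * Y ^ 2) ≤ 1 * (r * Y ^ 2) :=
        mul_le_mul_of_nonneg_right (min_le_right _ _) (by positivity)
      have := mul_le_mul_of_nonneg_left (add_le_add t1 t2) (by positivity : 0 ≤ m / 2)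
      rw [hm']
      linarith
    have k3 : c * E t ≤ m' * (W ^ 2 + r * Y ^ 2) := by
      have := mul_le_mul_of_nonneg_left (hupper t) hcp.le
      have e : c * (S₂ * (W ^ 2 + r * Y ^ 2)) = m' * (W ^ 2 + r * Y ^ 2) := by
        rw [hc]; field_simp
      linarith
    linarith
  have hanti : Antitone fun t => Real.exp (c * t) * E t := by
    have hd : ∀ t, HasDerivAt (fun t => Real.exp (c * t) * E t)
        (Real.exp (c * t) * c * E t + Real.exp (c * t) * E' t) t := fun t => by
      have h1 : HasDerivAt (fun t : ℝ => c * t) c t := by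
        simpa using (hasDerivAt_id t).const_mul c
      exact h1.exp.mul (hE t)
    refine antitone_of_deriv_nonpos (fun t => (hd t).differentiableAt) fun t => ?_
    rw [(hd t).deriv]
    have := mul_le_mul_of_nonneg_left (hdecay t) (Real.exp_pos (c * t)).le
    linarith
  intro t ht
  have hEt : E t ≤ Real.exp (-c * t) * E 0 := by
    have h := hanti ht
    simp only [mul_zero, Real.exp_zero, one_mul] at h
    rw [neg_mul, Real.exp_neg, ← div_eq_inv_mul, le_div_iff₀ (Real.exp_pos _)]
    linarith
  set N := ‖w 0‖ + ρ * ‖b 0‖ with hN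
  have hN0 : 0 ≤ N := by positivity
  have hfin : ‖w t‖ ^ 2 + (ρ * ‖b t‖) ^ 2 ≤ (C * Real.exp (-(c / 2) * t) * N) ^ 2 := by
    have e1 : Real.exp (-(c / 2) * t) ^ 2 = Real.exp (-c * t) := by
      rw [← Real.exp_nat_mul]; congr 1; push_cast; ring
    have h1 : s₁ * (‖w t‖ ^ 2 + r * ‖b t‖ ^ 2) ≤
        Real.exp (-c * t) * (S₂ * (‖w 0‖ ^ 2 + r * ‖b 0‖ ^ 2)) :=
      (hlower t).trans (hEt.trans (mul_le_mul_of_nonneg_left (hupper 0) (Real.exp_pos _).le))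
    have h2 : ‖w 0‖ ^ 2 + r * ‖b 0‖ ^ 2 ≤ N ^ 2 := by
      rw [hN, hr]
      have : 0 ≤ ‖w 0‖ * (ρ * ‖b 0‖) := by positivity
      linarith
    have h3 : ‖w t‖ ^ 2 + r * ‖b t‖ ^ 2 ≤ S₂ / s₁ * (Real.exp (-c * t) * N ^ 2) := by
      rw [div_mul_eq_mul_div, le_div_iff₀ hs₁p]
      have := mul_le_mul_of_nonneg_left h2 (by positivity : 0 ≤ Real.exp (-c * t) * S₂)
      linarith
    have h4 : S₂ / s₁ ≤ C ^ 2 := (le_max_right _ _).trans (le_self_pow₀ hC1 two_ne_zero)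
    have h5 := mul_le_mul_of_nonneg_right h4 (by positivity : 0 ≤ Real.exp (-c * t) * N ^ 2)
    rw [mul_pow (C * _) N, mul_pow C, e1, mul_pow ρ]
    linarith
  have hR : 0 ≤ C * Real.exp (-(c / 2) * t) * N := by positivity
  constructor
  · exact (sq_le_sq₀ (norm_nonneg _) hR).1 ((le_add_of_nonneg_right (sq_nonneg _)).trans hfin)
  · exact (sq_le_sq₀ (by positivity) hR).1 ((le_add_of_nonneg_left (sq_nonneg _)).trans hfin)

end DampedOscillator

/-! ### Decay of constrained states at complex frequencies -/

section ComplexSymbol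

/-- The symbol at a complex frequency. -/
def csymbolMatrix (p : Coeffs) (ζ : Fin 3 → ℂ) : Matrix Comp Comp ℂ := fun a b =>
  match a, b with
  | Sum.inl _, Sum.inr (Sum.inl k) => Complex.I * ζ k
  | Sum.inr (Sum.inl j), Sum.inl _ => Complex.I * (p.γ : ℂ) ^ 2 * ζ j
  | Sum.inr (Sum.inl j), Sum.inr (Sum.inl k) =>
      (if j = k then (p.ν : ℂ) * ∑ l, ζ l ^ 2 else 0) + (p.νt : ℂ) * ζ j * ζ k
  | Sum.inr (Sum.inl j), Sum.inr (Sum.inr (l, k)) =>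
      if l = j then - Complex.I * (p.β : ℂ) ^ 2 * ζ k else 0
  | Sum.inr (Sum.inr (j, k)), Sum.inr (Sum.inl l) =>
      if l = j then - Complex.I * ζ k else 0
  | _, _ => 0

/-- The symbol at a complex frequency, as an operator. -/
def csymbol (p : Coeffs) (ζ : Fin 3 → ℂ) : State →L[ℂ] State :=
  Matrix.toEuclideanCLM (𝕜 := ℂ) (csymbolMatrix p ζ)

lemma csymbol_ofReal (p : Coeffs) (ξ : E3) : csymbol p (fun k => (ξ k : ℂ)) = symbol p ξ := by
  unfold csymbol symbol
  congr 1

lemma csymbol_apply (p : Coeffs) (ζ : Fin 3 → ℂ) (u : State) (c : Comp) :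
    csymbol p ζ u c = ∑ d, csymbolMatrix p ζ c d * u d := by
  rw [csymbol, Matrix.ofLp_toEuclideanCLM]
  rfl

lemma phi_csymbol (p : Coeffs) (ζ : Fin 3 → ℂ) (u : State) :
    phi (csymbol p ζ u) = Complex.I * ∑ k, ζ k * vel u k := by
  simp only [phi, vel, csymbol_apply, csymbolMatrix, Fintype.sum_sum_type,
    Fintype.sum_prod_type, Fin.sum_univ_three]
  simp
  ring

lemma vel_csymbol (p : Coeffs) (ζ : Fin 3 → ℂ) (u : State) (j : Fin 3) :
    vel (csymbol p ζ u) j = Complex.I * (p.γ : ℂ) ^ 2 * ζ j * phi u +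
      p.ν * (∑ l, ζ l ^ 2) * vel u j + p.νt * ζ j * (∑ k, ζ k * vel u k) -
      Complex.I * (p.β : ℂ) ^ 2 * ∑ k, tens u j k * ζ k := by
  simp only [phi, vel, tens, csymbol_apply, csymbolMatrix, Fintype.sum_sum_type,
    Fintype.sum_prod_type]
  fin_cases j <;>
  · simp [Fin.sum_univ_three]
    ring

lemma tens_csymbol (p : Coeffs) (ζ : Fin 3 → ℂ) (u : State) (j k : Fin 3) :
    tens (csymbol p ζ u) j k = -Complex.I * ζ k * vel u j := by
  simp only [vel, tens, csymbol_apply, csymbolMatrix, Fintype.sum_sum_type,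
    Fintype.sum_prod_type]
  simp

lemma norm_phi_le (u : State) : ‖phi u‖ ≤ ‖u‖ := PiLp.norm_apply_le u _
lemma norm_vel_le (u : State) (j : Fin 3) : ‖vel u j‖ ≤ ‖u‖ := PiLp.norm_apply_le u _
lemma norm_tens_le (u : State) (j k : Fin 3) : ‖tens u j k‖ ≤ ‖u‖ := PiLp.norm_apply_le u _

lemma norm_le_of_components {u : State} {D : ℝ} (h0 : ‖phi u‖ ≤ D) (h1 : ∀ j, ‖vel u j‖ ≤ D)
    (h2 : ∀ j k, ‖tens u j k‖ ≤ D) : ‖u‖ ≤ 13 * D := by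
  have hD : 0 ≤ D := (norm_nonneg _).trans h0
  have hc : ∀ c, ‖u c‖ ≤ D := by
    rintro (_ | j | ⟨j, k⟩)
    exacts [h0, h1 j, h2 j k]
  refine (sq_le_sq₀ (norm_nonneg _) (by positivity)).1 ?_
  rw [EuclideanSpace.norm_sq_eq]
  calc ∑ c, ‖u c‖ ^ 2 ≤ ∑ _c : Comp, D ^ 2 :=
        Finset.sum_le_sum fun c _ => pow_le_pow_left₀ (norm_nonneg _) (hc c) 2
    _ = 13 * D ^ 2 := by simp
    _ ≤ (13 * D) ^ 2 := by nlinarith [sq_nonneg D]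

lemma hasDerivAt_component {v : ℝ → State} {v' : State} {t : ℝ} (h : HasDerivAt v v' t)
    (c : Comp) : HasDerivAt (fun s => v s c) (v' c) t :=
  ((EuclideanSpace.proj (𝕜 := ℂ) c).restrictScalars ℝ).hasFDerivAt.comp_hasDerivAt t h

/-- `u` satisfies the algebraic constraints `φ + tr G = 0` and `(ζ·ζ) G = (Gζ) ⊗ ζ`. -/
def Constrained (ζ : Fin 3 → ℂ) (u : State) : Prop :=
  phi u + ∑ k, tens u k k = 0 ∧
    ∀ j k, (∑ l, ζ l ^ 2) * tens u j k = (∑ l, tens u j l * ζ l) * ζ k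

/-- The constraint expressions are conserved: φ' = -iζ·w cancels tr G' = iζ·w, and G' = i w ⊗ ζ
already has the required tensor form. -/
lemma Constrained.flow {p : Coeffs} {ζ : Fin 3 → ℂ} {v : ℝ → State}
    (hv : ∀ t, HasDerivAt v (-csymbol p ζ (v t)) t) (h0 : Constrained ζ (v 0)) (t : ℝ) :
    Constrained ζ (v t) := by
  have hφ : ∀ t, HasDerivAt (fun s => phi (v s)) (-(Complex.I * ∑ k, ζ k * vel (v t) k)) t :=
    fun t => by
      have := hasDerivAt_component (hv t) (Sum.inl ())
      rw [← phi_csymbol p]; exact this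
  have hG : ∀ j k t, HasDerivAt (fun s => tens (v s) j k) (-(-Complex.I * ζ k * vel (v t) j)) t :=
    fun j k t => by
      have := hasDerivAt_component (hv t) (Sum.inr (Sum.inr (j, k)))
      rw [← tens_csymbol p]; exact this
  have hconst : ∀ f : ℝ → ℂ, (∀ t, HasDerivAt f 0 t) → f t = f 0 := fun f hf =>
    is_const_of_deriv_eq_zero (fun s => (hf s).differentiableAt) (fun s => (hf s).deriv) t 0
  constructor
  · rw [← h0.1]
    refine hconst (fun t => phi (v t) + ∑ k, tens (v t) k k) fun s => ?_
    convert! (hφ s).add (HasDerivAt.fun_sum fun k _ => hG k k s) using 1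
    simp only [Fin.sum_univ_three]
    ring
  · intro j k
    have h := hconst (fun t => (∑ l, ζ l ^ 2) * tens (v t) j k -
      (∑ l, tens (v t) j l * ζ l) * ζ k) fun s => by
        convert! ((hG j k s).const_mul (∑ l, ζ l ^ 2)).sub
          ((HasDerivAt.fun_sum fun l (_ : l ∈ Finset.univ) =>
            (hG j l s).mul_const (ζ l)).mul_const (ζ k)) using 1
        simp only [Fin.sum_univ_three]
        ring
    simp only [h0.2 j k, sub_self] at h
    exact sub_eq_zero.1 h

/-- Strict positivity follows from 3ν̃ = ν + (2ν + 3ν'). -/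
lemma Coeffs.νt_pos (p : Coeffs) : 0 < p.νt := by
  have h1 := p.ν_pos
  have h2 := p.visc_nonneg
  unfold Coeffs.νt
  linarith

/-- Uniform exponential decay of constrained solutions of `v' = -L̂(ζ) v` for complex frequencies
`ζ` close to the real ones and away from the origin. -/
lemma exists_constrained_decay (p : Coeffs) {ρ₀ : ℝ} (hρ₀ : 0 < ρ₀) :
    ∃ ε > 0, ∃ C > 0, ∃ c > 0, ∀ ρ ≥ ρ₀, ∀ ζ : Fin 3 → ℂ, (∀ j, ‖ζ j‖ ≤ 2 * ρ) →
      ρ ^ 2 / 2 ≤ ‖∑ l, ζ l ^ 2‖ →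
      ‖∑ l, ζ l ^ 2 - (ρ ^ 2 : ℝ)‖ ≤ ε * ρ ^ 2 → ∀ v : ℝ → State,
      (∀ t, HasDerivAt v (-csymbol p ζ (v t)) t) → Constrained ζ (v 0) →
      ∀ t ≥ 0, ‖v t‖ ≤ C * Real.exp (-c * t) * ‖v 0‖ := by
  obtain ⟨ε₁, hε₁, C₁, hC₁, c₁, hc₁, H₁⟩ := exists_damped_decay p.ν_pos
    (pow_pos p.β_pos 2) hρ₀
  obtain ⟨ε₂, hε₂, C₂, hC₂, c₂, hc₂, H₂⟩ := exists_damped_decay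
    (add_pos p.ν_pos p.νt_pos) (add_pos (pow_pos p.β_pos 2) (pow_pos p.γ_pos 2)) hρ₀
  -- Here 41 = 25 + 16 bounds the initial data of `wt` and `bt`; 28 = 4 · 7 combines the bound 4/ρ
  -- of ζ/z with the data 6ρ + ρ of σ and ρτ; the 2 comes from ‖ζ k‖ ≤ 2ρ when G is rebuilt, and 13
  -- counts components.
  refine ⟨min ε₁ ε₂, lt_min hε₁ hε₂, 13 * (2 * (41 * C₁ + 28 * C₂)), by positivity, min c₁ c₂,
    lt_min hc₁ hc₂, ?_⟩
  intro ρ hρ ζ hζ hz hzε v hv h0 t ht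
  have hρp : 0 < ρ := hρ₀.trans_le hρ
  have hcon := Constrained.flow hv h0
  set z : ℂ := ∑ l, ζ l ^ 2 with hzdef
  have hzn : 0 < ‖z‖ := lt_of_lt_of_le (by positivity) hz
  have hz0 : z ≠ 0 := norm_pos_iff.1 hzn
  set a := ‖v 0‖ with ha
  have ha0 : 0 ≤ a := norm_nonneg _
  have hε₁' : ‖z - (ρ ^ 2 : ℝ)‖ ≤ ε₁ * ρ ^ 2 :=
    hzε.trans (mul_le_mul_of_nonneg_right (min_le_left _ _) (sq_nonneg _))
  have hε₂' : ‖z - (ρ ^ 2 : ℝ)‖ ≤ ε₂ * ρ ^ 2 :=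
    hzε.trans (mul_le_mul_of_nonneg_right (min_le_right _ _) (sq_nonneg _))
  have hζz : ∀ j, ‖ζ j / z‖ ≤ 4 / ρ := fun j => by
    rw [norm_div, div_le_div_iff₀ hzn hρp]
    nlinarith [hζ j]
  let σ : ℝ → ℂ := fun s => ∑ k, ζ k * vel (v s) k
  let τ : ℝ → ℂ := fun s => Complex.I * phi (v s)
  let g : Fin 3 → ℝ → ℂ := fun j s => ∑ k, tens (v s) j k * ζ k
  -- The transformed displacement: the gradient constraint becomes G = i b ⊗ ζ, and b' = w.
  let b : Fin 3 → ℝ → ℂ := fun j s => -Complex.I * g j s / z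
  have hI : Complex.I * Complex.I = -1 := Complex.I_mul_I
  have hφ : ∀ s, HasDerivAt (fun s => phi (v s)) (-(Complex.I * σ s)) s := fun s => by
    have := hasDerivAt_component (hv s) (Sum.inl ())
    rw [← phi_csymbol p]; exact this
  have hG : ∀ j k s, HasDerivAt (fun s => tens (v s) j k) (-(-Complex.I * ζ k * vel (v s) j)) s :=
    fun j k s => by
      have := hasDerivAt_component (hv s) (Sum.inr (Sum.inr (j, k)))
      rw [← tens_csymbol p]; exact this
  have hw : ∀ j s, HasDerivAt (fun s => vel (v s) j) (-(Complex.I * (p.γ : ℂ) ^ 2 * ζ j * phi (v s)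
      + p.ν * z * vel (v s) j + p.νt * ζ j * σ s - Complex.I * (p.β : ℂ) ^ 2 * g j s)) s :=
    fun j s => by
      have := hasDerivAt_component (hv s) (Sum.inr (Sum.inl j))
      rw [← vel_csymbol p]; exact this
  have hτ' : ∀ s, HasDerivAt τ (σ s) s := fun s => by
    convert! (hφ s).const_mul Complex.I using 1
    linear_combination (σ s) * hI
  -- Both constraints meet here: the elastic stress in the equation for σ = ζ·w becomes a multiple
  -- of φ, which closes the pair (τ, σ) and adds β² to γ².
  have hgζ : ∀ s, ∑ j, ζ j * g j s = -z * phi (v s) := fun s => by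
    have h1 := (hcon s).1
    have h2 := (hcon s).2
    have h3 : ∑ j, ζ j * g j s = ∑ j, z * tens (v s) j j :=
      Finset.sum_congr rfl fun j _ => by rw [h2 j j, mul_comm]
    rw [h3, ← Finset.mul_sum]
    linear_combination z * h1
  have hσ' : ∀ s, HasDerivAt σ (-(((p.ν + p.νt : ℝ) : ℂ) * z * σ s) -
      ((p.β ^ 2 + p.γ ^ 2 : ℝ) : ℂ) * z * τ s) s := fun s => by
    convert! HasDerivAt.fun_sum (u := Finset.univ) fun k _ => (hw k s).const_mul (ζ k) using 1
    have e := hgζ s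
    simp only [Fin.sum_univ_three, hzdef, σ, τ] at e ⊢
    push_cast
    linear_combination (-Complex.I * (p.β : ℂ) ^ 2) * e
  have hb' : ∀ j s, HasDerivAt (b j) (vel (v s) j) s := fun j s => by
    have h1 := ((HasDerivAt.fun_sum (u := Finset.univ) fun k _ =>
      (hG j k s).mul_const (ζ k)).const_mul (-Complex.I)).div_const z
    convert! h1 using 1
    rw [eq_div_iff hz0]
    simp only [Fin.sum_univ_three, hzdef]
    linear_combination (vel (v s) j * (ζ 0 ^ 2 + ζ 1 ^ 2 + ζ 2 ^ 2)) * hI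
  have hgb : ∀ j s, g j s = Complex.I * z * b j s := fun j s => by
    simp only [b]
    field_simp
    linear_combination (g j s) * hI
  -- Removing the components along ζ eliminates the pressure and the ν̃ term, so each coordinate
  -- solves an oscillator with coefficients ν and β².
  let wt : Fin 3 → ℝ → ℂ := fun j s => vel (v s) j - ζ j / z * σ s
  let bt : Fin 3 → ℝ → ℂ := fun j s => b j s - ζ j / z * τ s
  have hbt : ∀ j s, HasDerivAt (bt j) (wt j s) s := fun j s =>
    (hb' j s).sub ((hτ' s).const_mul _)
  have hwt : ∀ j s, HasDerivAt (wt j) (-((p.ν : ℂ) * z * wt j s) -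
      ((p.β ^ 2 : ℝ) : ℂ) * z * bt j s) s := fun j s => by
    convert! (hw j s).sub ((hσ' s).const_mul (ζ j / z)) using 1
    rw [hgb]
    simp only [wt, bt, τ]
    push_cast
    field_simp
    linear_combination (-(p.β : ℂ) ^ 2 * z * b j s) * hI
  have hσ0 : ‖σ 0‖ ≤ 6 * ρ * a := by
    refine (norm_sum_le _ _).trans ?_
    have : ∀ k ∈ Finset.univ, ‖ζ k * vel (v 0) k‖ ≤ 2 * ρ * a := fun k _ => by
      rw [norm_mul]
      exact mul_le_mul (hζ k) (norm_vel_le _ _) (norm_nonneg _) (by positivity)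
    refine (Finset.sum_le_sum this).trans_eq ?_
    simp; ring
  have hτ0 : ‖τ 0‖ ≤ a := by
    simp only [τ, norm_mul, Complex.norm_I, one_mul]
    exact norm_phi_le _
  have hg0 : ∀ j, ‖g j 0‖ ≤ 6 * ρ * a := fun j => by
    refine (norm_sum_le _ _).trans ?_
    have : ∀ k ∈ Finset.univ, ‖tens (v 0) j k * ζ k‖ ≤ 2 * ρ * a := fun k _ => by
      rw [norm_mul, mul_comm]
      exact mul_le_mul (hζ k) (norm_tens_le _ _ _) (norm_nonneg _) (by positivity)
    refine (Finset.sum_le_sum this).trans_eq ?_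
    simp; ring
  have hb0 : ∀ j, ρ * ‖b j 0‖ ≤ 12 * a := fun j => by
    simp only [b, norm_div, norm_mul, norm_neg, Complex.norm_I, one_mul]
    rw [← mul_div_assoc, div_le_iff₀ hzn]
    have := mul_le_mul_of_nonneg_left (hg0 j) hρp.le
    have := mul_le_mul_of_nonneg_left hz (by positivity : 0 ≤ 12 * a)
    linarith
  have hzs : ∀ j (s : ℂ) (S : ℝ), ‖s‖ ≤ S → ‖ζ j / z * s‖ ≤ 4 / ρ * S := fun j s S hS => by
    rw [norm_mul]
    exact mul_le_mul (hζz j) hS (norm_nonneg _) (by positivity)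
  have hwt0 : ∀ j, ‖wt j 0‖ ≤ 25 * a := fun j => by
    refine (norm_sub_le _ _).trans ?_
    have h1 := hzs j _ _ hσ0
    have e : 4 / ρ * (6 * ρ * a) = 24 * a := by field_simp; ring
    have := norm_vel_le (v 0) j
    linarith
  have hbt0 : ∀ j, ρ * ‖bt j 0‖ ≤ 16 * a := fun j => by
    have h1 := mul_le_mul_of_nonneg_left (hzs j _ _ hτ0) hρp.le
    have h2 := mul_le_mul_of_nonneg_left (norm_sub_le (b j 0) (ζ j / z * τ 0)) hρp.le
    have e : ρ * (4 / ρ * a) = 4 * a := by field_simp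
    have := hb0 j
    change ρ * ‖b j 0 - ζ j / z * τ 0‖ ≤ _
    linarith
  set e := Real.exp (-(min c₁ c₂) * t) with he
  have he0 : 0 < e := Real.exp_pos _
  have he1 : Real.exp (-c₁ * t) ≤ e := Real.exp_le_exp.2
    (mul_le_mul_of_nonneg_right (neg_le_neg (min_le_left _ _)) ht)
  have he2 : Real.exp (-c₂ * t) ≤ e := Real.exp_le_exp.2
    (mul_le_mul_of_nonneg_right (neg_le_neg (min_le_right _ _)) ht)
  have R2 : C₂ * Real.exp (-c₂ * t) * (‖σ 0‖ + ρ * ‖τ 0‖) ≤ C₂ * e * (7 * ρ * a) := by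
    refine mul_le_mul (mul_le_mul_of_nonneg_left he2 (by positivity)) ?_ (by positivity)
      (by positivity)
    have := mul_le_mul_of_nonneg_left hτ0 hρp.le
    linarith
  have R1 : ∀ j, C₁ * Real.exp (-c₁ * t) * (‖wt j 0‖ + ρ * ‖bt j 0‖) ≤ C₁ * e * (41 * a) :=
    fun j => by
      refine mul_le_mul (mul_le_mul_of_nonneg_left he1 (by positivity)) ?_ (by positivity)
        (by positivity)
      linarith [hwt0 j, hbt0 j]
  obtain ⟨S1, S2⟩ := H₂ ρ hρ z hε₂' τ σ hτ' hσ' t ht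
  have T : ∀ j, ‖wt j t‖ ≤ C₁ * e * (41 * a) ∧ ρ * ‖bt j t‖ ≤ C₁ * e * (41 * a) := fun j => by
    obtain ⟨h1, h2⟩ := H₁ ρ hρ z hε₁' (bt j) (wt j) (hbt j) (hwt j) t ht
    exact ⟨h1.trans (R1 j), h2.trans (R1 j)⟩
  have hσt : ‖σ t‖ ≤ C₂ * e * (7 * ρ * a) := S1.trans R2
  have hτt : ‖τ t‖ ≤ C₂ * e * (7 * a) := by
    refine le_of_mul_le_mul_left ((S2.trans R2).trans_eq ?_) hρp
    ring
  have hCea₁ : 0 ≤ C₁ * e * a := by positivity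
  have hCea₂ : 0 ≤ C₂ * e * a := by positivity
  set D := 2 * (41 * C₁ + 28 * C₂) * e * a with hD
  have hbnd : ∀ j, ρ * ‖b j t‖ ≤ (41 * C₁ + 28 * C₂) * e * a := fun j => by
    have h1 := mul_le_mul_of_nonneg_left (hzs j _ _ hτt) hρp.le
    have h2 := mul_le_mul_of_nonneg_left (norm_add_le (bt j t) (ζ j / z * τ t)) hρp.le
    have e1 : ρ * (4 / ρ * (C₂ * e * (7 * a))) = 28 * C₂ * e * a := by field_simp; ring
    have e2 : bt j t + ζ j / z * τ t = b j t := sub_add_cancel _ _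
    rw [e2] at h2
    linarith [(T j).2]
  have key : ‖v t‖ ≤ 13 * D := by
    refine norm_le_of_components ?_ (fun j => ?_) fun j k => ?_
    · simp only [τ, norm_mul, Complex.norm_I, one_mul] at hτt
      linarith
    · have h1 := hzs j _ _ hσt
      have h2 := norm_add_le (wt j t) (ζ j / z * σ t)
      have e1 : 4 / ρ * (C₂ * e * (7 * ρ * a)) = 28 * C₂ * e * a := by field_simp; ring
      have e2 : wt j t + ζ j / z * σ t = vel (v t) j := sub_add_cancel _ _
      rw [e2] at h2
      linarith [(T j).1]
    · have e1 : tens (v t) j k = Complex.I * b j t * ζ k := by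
        have h2 := (hcon t).2 j k
        have h3 : z * tens (v t) j k = z * (Complex.I * b j t * ζ k) := by
          rw [h2]
          change g j t * ζ k = _
          rw [hgb]; ring
        exact mul_left_cancel₀ hz0 h3
      rw [e1, norm_mul, norm_mul, Complex.norm_I, one_mul]
      have h4 := mul_le_mul_of_nonneg_left (hζ k) (norm_nonneg (b j t))
      linarith [hbnd j]
  refine key.trans_eq ?_
  rw [hD]; ring

end ComplexSymbol

/-! ### The projection onto constrained states -/

section ConstraintProjection

/-- The projection onto the states satisfying `φ + tr G = 0` and `(ζ·ζ) G = (Gζ) ⊗ ζ`. -/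
def constraintProj (ζ : Fin 3 → ℂ) (u : State) : State :=
  WithLp.toLp 2 fun c => match c with
    | Sum.inl _ => -(∑ j, ∑ k, ζ j * (tens u j k * ζ k)) / ∑ l, ζ l ^ 2
    | Sum.inr (Sum.inl j) => vel u j
    | Sum.inr (Sum.inr (j, k)) => (∑ l, tens u j l * ζ l) * ζ k / ∑ l, ζ l ^ 2

lemma phi_constraintProj (ζ : Fin 3 → ℂ) (u : State) : phi (constraintProj ζ u) =
    -(∑ j, ∑ k, ζ j * (tens u j k * ζ k)) / ∑ l, ζ l ^ 2 := rfl

lemma vel_constraintProj (ζ : Fin 3 → ℂ) (u : State) (j : Fin 3) :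
    vel (constraintProj ζ u) j = vel u j := rfl

lemma tens_constraintProj (ζ : Fin 3 → ℂ) (u : State) (j k : Fin 3) :
    tens (constraintProj ζ u) j k = (∑ l, tens u j l * ζ l) * ζ k / ∑ l, ζ l ^ 2 := rfl

lemma constrained_constraintProj {ζ : Fin 3 → ℂ} (hz : ∑ l, ζ l ^ 2 ≠ 0) (u : State) :
    Constrained ζ (constraintProj ζ u) := by
  constructor
  · rw [phi_constraintProj]
    simp only [tens_constraintProj]
    rw [← Finset.sum_div, ← add_div, div_eq_zero_iff]
    left
    simp only [Fin.sum_univ_three]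
    ring
  · intro j k
    simp only [tens_constraintProj]
    rw [mul_div_cancel₀ _ hz]
    have : ∑ l, (∑ i, tens u j i * ζ i) * ζ l / (∑ i, ζ i ^ 2) * ζ l =
        (∑ i, tens u j i * ζ i) * (∑ l, ζ l ^ 2) / (∑ i, ζ i ^ 2) := by
      rw [Finset.mul_sum, Finset.sum_div]
      exact Finset.sum_congr rfl fun l _ => by ring
    rw [this, mul_div_cancel_right₀ _ hz]

lemma constraintProj_eq_self {ζ : Fin 3 → ℂ} (hz : ∑ l, ζ l ^ 2 ≠ 0) {u : State}
    (hu : Constrained ζ u) : constraintProj ζ u = u := by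
  ext c
  rcases c with ⟨⟩ | j | ⟨j, k⟩
  · change phi _ = phi u
    rw [phi_constraintProj, div_eq_iff hz]
    have h : ∀ j, ∑ k, ζ j * (tens u j k * ζ k) = (∑ l, ζ l ^ 2) * tens u j j := fun j => by
      rw [hu.2 j j, ← Finset.mul_sum, mul_comm]
    rw [Finset.sum_congr rfl fun j _ => h j, ← Finset.mul_sum]
    linear_combination (-∑ l, ζ l ^ 2) * hu.1
  · rfl
  · change tens _ j k = tens u j k
    rw [tens_constraintProj, div_eq_iff hz, ← hu.2 j k, mul_comm]

/-- The projection is homogeneous of degree zero in ζ, so its bound is free of ρ. The 72 is nine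
terms of size 4ρ²‖u‖ divided by ρ²/2; 13 counts components. -/
lemma norm_constraintProj_le {ζ : Fin 3 → ℂ} {ρ : ℝ} (hρ : 0 < ρ) (hζ : ∀ j, ‖ζ j‖ ≤ 2 * ρ)
    (hz : ρ ^ 2 / 2 ≤ ‖∑ l, ζ l ^ 2‖) (u : State) : ‖constraintProj ζ u‖ ≤ 13 * (72 * ‖u‖) := by
  have hzn : 0 < ‖∑ l, ζ l ^ 2‖ := lt_of_lt_of_le (by positivity) hz
  have hu := norm_nonneg u
  have hpos := mul_nonneg (sq_nonneg ρ) hu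
  have h1 : ∀ j k l m, ‖ζ j * (tens u l m * ζ k)‖ ≤ 4 * ρ ^ 2 * ‖u‖ := fun j k l m => by
    rw [norm_mul, norm_mul]
    calc ‖ζ j‖ * (‖tens u l m‖ * ‖ζ k‖) ≤ (2 * ρ) * (‖u‖ * (2 * ρ)) :=
          mul_le_mul (hζ j) (mul_le_mul (norm_tens_le _ _ _) (hζ k) (norm_nonneg _) hu)
            (by positivity) (by positivity)
      _ = 4 * ρ ^ 2 * ‖u‖ := by ring
  have hz' := mul_le_mul_of_nonneg_right hz hu
  refine norm_le_of_components ?_ (fun j => ?_) fun j k => ?_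
  · rw [phi_constraintProj, norm_div, norm_neg, div_le_iff₀ hzn]
    have h2 : ‖∑ j, ∑ k, ζ j * (tens u j k * ζ k)‖ ≤ ∑ _j : Fin 3, ∑ _k : Fin 3, 4 * ρ ^ 2 * ‖u‖ :=
      norm_sum_le_of_le _ fun j _ => norm_sum_le_of_le _ fun k _ => h1 j k j k
    refine h2.trans ?_
    simp only [Finset.sum_const, Finset.card_univ, Fintype.card_fin, nsmul_eq_mul]
    push_cast
    linarith
  · rw [vel_constraintProj]
    linarith [norm_vel_le u j]
  · rw [tens_constraintProj, norm_div, div_le_iff₀ hzn, Finset.sum_mul]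
    have h2 : ‖∑ l, tens u j l * ζ l * ζ k‖ ≤ ∑ _l : Fin 3, 4 * ρ ^ 2 * ‖u‖ :=
      norm_sum_le_of_le _ fun l _ => by
        have := h1 k l j l
        rwa [mul_comm] at this
    refine h2.trans ?_
    simp only [Finset.sum_const, Finset.card_univ, Fintype.card_fin, nsmul_eq_mul]
    push_cast
    linarith

end ConstraintProjection

/-! ### Holomorphic extension of the symbol -/

section AnalyticSymbol

/-- The symbol of `(1 - Δ)⁻¹ e^{-tL}` on constrained states, at a complex frequency. -/
def decaySymbol (p : Coeffs) (t : ℝ) (u : State) (ζ : Fin 3 → ℂ) : State :=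
  (1 + ∑ l, ζ l ^ 2)⁻¹ • NormedSpace.exp (-t • csymbol p ζ) (constraintProj ζ u)

lemma contDiff_csymbol (p : Coeffs) : ContDiff ℂ ∞ (csymbol p) := by
  have h : ContDiff ℂ (F := Comp → Comp → ℂ) ∞ (csymbolMatrix p) := by
    refine contDiff_pi.2 fun a => contDiff_pi.2 fun b => ?_
    rcases a with a | a | ⟨a, a'⟩ <;> rcases b with b | b | ⟨b, b'⟩ <;>
      simp only [csymbolMatrix] <;> (try split_ifs) <;> fun_prop
  let T : (Comp → Comp → ℂ) →ₗ[ℂ] (State →L[ℂ] State) :=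
    (Matrix.toEuclideanCLM (n := Comp) (𝕜 := ℂ)).toAlgEquiv.toLinearMap
  exact (LinearMap.toContinuousLinearMap T).contDiff.comp h

lemma contDiffAt_constraintProj (u : State) {ζ : Fin 3 → ℂ} (hz : ∑ l, ζ l ^ 2 ≠ 0) :
    ContDiffAt ℂ ∞ (fun ζ => constraintProj ζ u) ζ := by
  have hzc : ContDiffAt ℂ ∞ (fun ζ : Fin 3 → ℂ => (∑ l, ζ l ^ 2)⁻¹) ζ :=
    ContDiffAt.inv (by fun_prop) hz
  rw [contDiffAt_euclidean]
  rintro (_ | j | ⟨j, k⟩)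
  · simp only [constraintProj, div_eq_mul_inv]
    exact ContDiffAt.mul (by fun_prop) hzc
  · exact contDiffAt_const
  · simp only [constraintProj, div_eq_mul_inv]
    exact ContDiffAt.mul (by fun_prop) hzc

lemma contDiffAt_decaySymbol (p : Coeffs) (t : ℝ) (u : State) {ζ : Fin 3 → ℂ}
    (hz : ∑ l, ζ l ^ 2 ≠ 0) (hz1 : 1 + ∑ l, ζ l ^ 2 ≠ 0) :
    ContDiffAt ℂ ∞ (decaySymbol p t u) ζ := by
  have h1 : ContDiffAt ℂ ∞ (fun ζ : Fin 3 → ℂ => (1 + ∑ l, ζ l ^ 2)⁻¹) ζ :=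
    ContDiffAt.inv (by fun_prop) hz1
  have h2 : ContDiffAt ℂ ∞ (fun ζ : Fin 3 → ℂ => NormedSpace.exp (-t • csymbol p ζ)) ζ := by
    have h3 : ContDiffAt ℂ ∞ (fun ζ : Fin 3 → ℂ => -t • csymbol p ζ) ζ :=
      ((contDiff_csymbol p).const_smul (-t)).contDiffAt
    exact (NormedSpace.exp_analytic (𝕂 := ℂ) (-t • csymbol p ζ)).contDiffAt.comp ζ h3
  exact h1.smul (h2.clm_apply (contDiffAt_constraintProj u hz))

/-- Moving one coordinate by s changes ζ·ζ by 2sη_j + s². For |s| ≤ δ this is small relative to |η|²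
as long as |η| ≥ ρ₀, so a single δ serves all frequencies. -/
lemma exists_decaySymbol_bound (p : Coeffs) {ρ₀ : ℝ} (hρ₀ : 0 < ρ₀) :
    ∃ δ > 0, ∃ C > 0, ∃ c > 0, ∀ (η : E3), ρ₀ ≤ ‖η‖ → ∀ (j : Fin 3) (s : ℂ), ‖s‖ ≤ δ →
      (∑ l, ((η l : ℂ) + if l = j then s else 0) ^ 2 ≠ 0 ∧
        1 + ∑ l, ((η l : ℂ) + if l = j then s else 0) ^ 2 ≠ 0) ∧
      ∀ t ≥ 0, ∀ u : State, ‖decaySymbol p t u fun l => (η l : ℂ) + if l = j then s else 0‖ ≤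
        C * Real.exp (-c * t) * ‖u‖ * (1 + ‖η‖ ^ 2)⁻¹ := by
  obtain ⟨ε, hε, C, hC, c, hc, H⟩ := exists_constrained_decay p hρ₀
  -- The cap 1/2 keeps |z| ≥ ρ²/2 and |1 + z| ≥ (1 + ρ²)/2. In the radius ε'ρ₀/3, the third pays for
  -- 2sη_j + s²: two parts for the first term and at most one for the second.
  set ε' := min ε (1 / 2) with hε'
  have hε'p : 0 < ε' := lt_min hε (by norm_num)
  have hε'1 : ε' ≤ 1 / 2 := min_le_right _ _
  refine ⟨ε' / 3 * ρ₀, by positivity, 2 * (C * (13 * 72)), by positivity, c, hc,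
    fun η hη j s hs => ?_⟩
  set ρ := ‖η‖ with hρ
  have hρp : 0 < ρ := hρ₀.trans_le hη
  set ζ : Fin 3 → ℂ := fun l => (η l : ℂ) + if l = j then s else 0 with hζdef
  have hs' : ‖s‖ ≤ ε' / 3 * ρ := hs.trans (mul_le_mul_of_nonneg_left hη (by positivity))
  have hηj : ∀ l, ‖(η l : ℂ)‖ ≤ ρ := fun l => by
    rw [Complex.norm_real]; exact PiLp.norm_apply_le η l
  have hζ : ∀ l, ‖ζ l‖ ≤ 2 * ρ := fun l => by
    refine (norm_add_le _ _).trans ?_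
    have h1 : ‖(if l = j then s else 0 : ℂ)‖ ≤ ‖s‖ := by
      split_ifs <;> simp
    nlinarith [hηj l]
  have hzr : ∑ l, ζ l ^ 2 - (ρ ^ 2 : ℝ) = 2 * s * η j + s ^ 2 := by
    have h1 : ((ρ ^ 2 : ℝ) : ℂ) = ∑ l, (η l : ℂ) ^ 2 := by
      rw [hρ, EuclideanSpace.norm_sq_eq]
      push_cast
      exact Finset.sum_congr rfl fun l _ => by
        rw [← Complex.ofReal_pow, ← Complex.ofReal_pow, Real.norm_eq_abs, sq_abs]
    have h2 : ∀ l, ζ l ^ 2 = (η l : ℂ) ^ 2 + if l = j then 2 * s * η j + s ^ 2 else 0 := fun l => by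
      simp only [hζdef]
      split_ifs with h
      · subst h; ring
      · ring
    rw [h1, Finset.sum_congr rfl fun l _ => h2 l, Finset.sum_add_distrib]
    simp
  have hzd : ‖∑ l, ζ l ^ 2 - (ρ ^ 2 : ℝ)‖ ≤ ε' * ρ ^ 2 := by
    rw [hzr]
    refine (norm_add_le _ _).trans ?_
    rw [norm_mul, norm_mul, norm_pow, Complex.norm_ofNat]
    have h1 : ‖s‖ * ‖(η j : ℂ)‖ ≤ ε' / 3 * ρ * ρ :=
      mul_le_mul hs' (hηj j) (norm_nonneg _) (by positivity)
    have h2 : ‖s‖ ^ 2 ≤ (ε' / 3 * ρ) ^ 2 := pow_le_pow_left₀ (norm_nonneg _) hs' 2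
    have h3 : (ε' / 3 * ρ) ^ 2 ≤ ε' / 3 * ρ ^ 2 := by
      rw [mul_pow]
      refine mul_le_mul_of_nonneg_right ?_ (sq_nonneg _)
      nlinarith
    linarith
  have hzε : ‖∑ l, ζ l ^ 2 - (ρ ^ 2 : ℝ)‖ ≤ ε * ρ ^ 2 :=
    hzd.trans (mul_le_mul_of_nonneg_right (min_le_left _ _) (sq_nonneg _))
  have hzd2 : ‖∑ l, ζ l ^ 2 - (ρ ^ 2 : ℝ)‖ ≤ 1 / 2 * ρ ^ 2 :=
    hzd.trans (mul_le_mul_of_nonneg_right hε'1 (sq_nonneg _))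
  have hz : ρ ^ 2 / 2 ≤ ‖∑ l, ζ l ^ 2‖ := by
    have h1 := norm_sub_norm_le ((ρ ^ 2 : ℝ) : ℂ) (∑ l, ζ l ^ 2)
    rw [norm_sub_rev, Complex.norm_of_nonneg (sq_nonneg ρ)] at h1
    linarith
  have hz1 : (1 + ρ ^ 2) / 2 ≤ ‖1 + ∑ l, ζ l ^ 2‖ := by
    have h1 := norm_sub_norm_le ((1 + ρ ^ 2 : ℝ) : ℂ) (1 + ∑ l, ζ l ^ 2)
    have e : ((1 + ρ ^ 2 : ℝ) : ℂ) - (1 + ∑ l, ζ l ^ 2) = -(∑ l, ζ l ^ 2 - (ρ ^ 2 : ℝ)) := by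
      push_cast; ring
    rw [e, norm_neg, Complex.norm_of_nonneg (by positivity)] at h1
    linarith
  have hz0 : ∑ l, ζ l ^ 2 ≠ 0 := norm_pos_iff.1 (lt_of_lt_of_le (by positivity) hz)
  refine ⟨⟨hz0, norm_pos_iff.1 (lt_of_lt_of_le (by positivity) hz1)⟩, fun t ht u => ?_⟩
  let A : State →L[ℂ] State := -csymbol p ζ
  let v : ℝ → State := fun s => NormedSpace.exp (s • A) (constraintProj ζ u)
  have hv : ∀ s, HasDerivAt v (-csymbol p ζ (v s)) s := fun s =>
    (((ContinuousLinearMap.apply ℂ State (constraintProj ζ u)).restrictScalars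
      ℝ).hasFDerivAt.comp_hasDerivAt s (hasDerivAt_exp_smul_const' (𝕂 := ℝ) A s))
  have h0 : v 0 = constraintProj ζ u := by
    have : (0 : ℝ) • A = 0 := zero_smul ℝ A
    simp only [v, this, NormedSpace.exp_zero, one_apply_eq_self]
  have hvt : v t = NormedSpace.exp (-t • csymbol p ζ) (constraintProj ζ u) := by
    have : t • A = -t • csymbol p ζ := by
      rw [show A = -csymbol p ζ from rfl, smul_neg]; exact (neg_smul t (csymbol p ζ)).symm
    simp only [v, this]
  have hb := H ρ hη ζ hζ hz hzε v hv (by rw [h0]; exact constrained_constraintProj hz0 u) t ht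
  rw [decaySymbol, ← hvt, norm_smul, norm_inv]
  have hb' : ‖v t‖ ≤ C * Real.exp (-c * t) * (13 * (72 * ‖u‖)) := by
    refine hb.trans (mul_le_mul_of_nonneg_left ?_ (by positivity))
    rw [h0]
    exact norm_constraintProj_le hρp hζ hz u
  have hinv : ‖1 + ∑ l, ζ l ^ 2‖⁻¹ ≤ 2 * (1 + ρ ^ 2)⁻¹ := by
    have := inv_anti₀ (by positivity) hz1
    rwa [inv_div, div_eq_mul_inv] at this
  refine (mul_le_mul hinv hb' (norm_nonneg _) (by positivity)).trans_eq ?_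
  ring

end AnalyticSymbol

/-! ### Partial derivatives read off a holomorphic slice -/

section LineDerivatives

variable {F : Type*} [NormedAddCommGroup F] [NormedSpace ℂ F]

lemma hasDerivAt_line {f : E3 → F} {η : E3} (hf : DifferentiableAt ℝ f η) (j : Fin 3) {s : ℝ}
    {η₀ : E3} (h : η₀ + s • EuclideanSpace.single j (1 : ℝ) = η) :
    HasDerivAt (fun r : ℝ => f (η₀ + r • EuclideanSpace.single j (1 : ℝ))) (pd j f η) s := by
  have h1 : HasDerivAt (fun r : ℝ => η₀ + r • EuclideanSpace.single j (1 : ℝ))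
      (EuclideanSpace.single j (1 : ℝ)) s := by
    simpa using ((hasDerivAt_id s).smul_const (EuclideanSpace.single j (1 : ℝ))).const_add η₀
  subst h
  exact hf.hasFDerivAt.comp_hasDerivAt s h1

/-- A real derivative along the line is the complex derivative of the holomorphic extension `A`. The
identity for the first derivative is proved on a whole interval around 0, so that it can be
differentiated once more. -/
lemma pd_eq_deriv_of_line [CompleteSpace F] {f : E3 → F} {η : E3} (hf : ContDiffAt ℝ 2 f η)
    (j : Fin 3) {A : ℂ → F} {δ : ℝ} (hδ : 0 < δ)
    (hA : DifferentiableOn ℂ A (Metric.ball 0 δ))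
    (hfA : ∀ s : ℝ, ‖s‖ < δ → f (η + s • EuclideanSpace.single j (1 : ℝ)) = A s) :
    pd j f η = deriv A 0 ∧ pd j (pd j f) η = deriv (deriv A) 0 := by
  have hcont : Continuous fun s : ℝ => η + s • EuclideanSpace.single j (1 : ℝ) := by fun_prop
  have hlim : Filter.Tendsto (fun s : ℝ => η + s • EuclideanSpace.single j (1 : ℝ)) (nhds 0)
      (nhds η) := by
    simpa using hcont.tendsto 0
  have hd : ∀ᶠ y in nhds η, DifferentiableAt ℝ f y := by
    filter_upwards [hf.eventually (by simp)] with y hy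
    exact hy.differentiableAt (by simp)
  have hball : ∀ᶠ s : ℝ in nhds 0, ‖s‖ < δ := by
    have : Metric.ball (0 : ℝ) δ ∈ nhds 0 := Metric.ball_mem_nhds 0 hδ
    filter_upwards [this] with s hs
    simpa using hs
  have hcomp : ∀ {B : ℂ → F} {s : ℝ}, DifferentiableAt ℂ B s →
      HasDerivAt (fun r : ℝ => B r) (deriv B s) s := fun {B s} hB => by
    have := hB.hasDerivAt.scomp s (Complex.ofRealCLM.hasDerivAt (x := s))
    simpa [Function.comp_def] using this
  have hmem : ∀ {s : ℝ}, ‖s‖ < δ → (s : ℂ) ∈ Metric.ball (0 : ℂ) δ := fun hs => by simpa using hs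
  have h1 : ∀ᶠ s : ℝ in nhds 0,
      pd j f (η + s • EuclideanSpace.single j (1 : ℝ)) = deriv A s := by
    filter_upwards [hlim.eventually hd, hball.eventually_nhds] with s hs hsb
    refine (hasDerivAt_line hs j rfl).unique ?_
    refine (hcomp (hA.differentiableAt (Metric.isOpen_ball.mem_nhds
      (hmem hsb.self_of_nhds)))).congr_of_eventuallyEq ?_
    filter_upwards [hsb] with r hr
    exact hfA r hr
  have hpd : DifferentiableAt ℝ (pd j f) η := by
    unfold pd
    exact (((hf.fderiv_right (m := 1) (by norm_num)).differentiableAt one_ne_zero).clm_apply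
      (differentiableAt_const _))
  refine ⟨by simpa using h1.self_of_nhds, ?_⟩
  refine (hasDerivAt_line hpd j (s := 0) (η₀ := η) (by simp)).unique ?_
  have h2 := hcomp (B := deriv A) (s := 0) ((hA.deriv Metric.isOpen_ball).differentiableAt
    (Metric.isOpen_ball.mem_nhds (by simpa using hδ)))
  rw [Complex.ofReal_zero] at h2
  exact h2.congr_of_eventuallyEq h1

end LineDerivatives

/-! ### Symbol bounds at real frequencies -/

section RealFrequencies

/-- The symbol of `(1 - Δ)⁻¹ e^{-tL}` on constrained states, at a real frequency. -/
def realDecaySymbol (p : Coeffs) (t : ℝ) (u : State) (η : E3) : State :=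
  decaySymbol p t u fun l => (η l : ℂ)

lemma contDiffAt_realDecaySymbol (p : Coeffs) (t : ℝ) (u : State) {η : E3}
    (hz : ∑ l, (η l : ℂ) ^ 2 ≠ 0) (hz1 : 1 + ∑ l, (η l : ℂ) ^ 2 ≠ 0) :
    ContDiffAt ℝ ∞ (realDecaySymbol p t u) η := by
  have h := (contDiffAt_decaySymbol p t u (ζ := fun l => (η l : ℂ)) hz hz1).restrict_scalars ℝ
  have h2 : ContDiffAt ℝ ∞ (fun ξ : E3 => fun l => (ξ l : ℂ)) η := by
    refine contDiffAt_pi.2 fun l => ?_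
    exact Complex.ofRealCLM.contDiff.contDiffAt.comp η
      (EuclideanSpace.proj (𝕜 := ℝ) l).contDiff.contDiffAt
  exact h.comp η h2

/-- Cauchy's estimates on the circle |s| = δ turn the bound at complex frequencies into bounds for
derivatives, with factors 1/δ and 2!/δ². -/
lemma exists_realDecaySymbol_bound (p : Coeffs) {ρ₀ : ℝ} (hρ₀ : 0 < ρ₀) :
    ∃ C > 0, ∃ c > 0, ∀ t ≥ 0, ∀ (u : State) (η : E3), ρ₀ ≤ ‖η‖ →
      ContDiffAt ℝ ∞ (realDecaySymbol p t u) η ∧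
      ‖realDecaySymbol p t u η‖ ≤ C * Real.exp (-c * t) * ‖u‖ * (1 + ‖η‖ ^ 2)⁻¹ ∧
      (∀ j, ‖pd j (realDecaySymbol p t u) η‖ ≤
        C * Real.exp (-c * t) * ‖u‖ * (1 + ‖η‖ ^ 2)⁻¹) ∧
      ∀ j, ‖pd j (pd j (realDecaySymbol p t u)) η‖ ≤
        C * Real.exp (-c * t) * ‖u‖ * (1 + ‖η‖ ^ 2)⁻¹ := by
  obtain ⟨δ, hδ, C, hC, c, hc, H⟩ := exists_decaySymbol_bound p hρ₀
  refine ⟨C * (1 + 1 / δ + 2 / δ ^ 2), by positivity, c, hc, fun t ht u η hη => ?_⟩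
  set B := C * Real.exp (-c * t) * ‖u‖ * (1 + ‖η‖ ^ 2)⁻¹ with hB
  have hB0 : 0 ≤ B := by positivity
  have e : C * (1 + 1 / δ + 2 / δ ^ 2) * Real.exp (-c * t) * ‖u‖ * (1 + ‖η‖ ^ 2)⁻¹ =
      B + B / δ + 2 * B / δ ^ 2 := by rw [hB]; ring
  rw [e]
  have hp1 : 0 ≤ B / δ := by positivity
  have hp2 : 0 ≤ 2 * B / δ ^ 2 := by positivity
  -- A zero shift gives the statement at the real frequency itself; the coordinate chosen is
  -- immaterial.
  have h00 := H η hη 0 0 (by simpa using hδ.le)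
  simp only [ite_self, add_zero] at h00
  have hsm := contDiffAt_realDecaySymbol p t u h00.1.1 h00.1.2
  have hline : ∀ j, ∃ A : ℂ → State, pd j (realDecaySymbol p t u) η = deriv A 0 ∧
      pd j (pd j (realDecaySymbol p t u)) η = deriv (deriv A) 0 ∧
      DiffContOnCl ℂ A (Metric.ball 0 δ) ∧ ∀ z ∈ Metric.sphere (0 : ℂ) δ, ‖A z‖ ≤ B := fun j => by
    let A : ℂ → State := fun s =>
      decaySymbol p t u fun l => (η l : ℂ) + if l = j then s else 0
    have hA : DifferentiableOn ℂ A (Metric.closedBall 0 δ) := fun s hs => by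
      obtain ⟨⟨h1, h2⟩, -⟩ := H η hη j s (by simpa using hs)
      have h3 : DifferentiableAt ℂ (fun s : ℂ => fun l => (η l : ℂ) + if l = j then s else 0) s := by
        refine differentiableAt_pi.2 fun l => ?_
        split_ifs <;> fun_prop
      exact (((contDiffAt_decaySymbol p t u h1 h2).differentiableAt (by simp)).comp s
        h3).differentiableWithinAt
    have hAl := pd_eq_deriv_of_line (hsm.of_le (by norm_cast)) j hδ
      (hA.mono Metric.ball_subset_closedBall) (fun s _ => by
        simp only [realDecaySymbol, A]
        congr 1
        funext l
        simp only [PiLp.add_apply, PiLp.smul_apply, PiLp.single_apply, smul_eq_mul]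
        split_ifs <;> simp)
    refine ⟨A, hAl.1, hAl.2, ?_, fun z hz => ?_⟩
    · refine DifferentiableOn.diffContOnCl ?_
      rwa [closure_ball _ hδ.ne']
    · exact (H η hη j z (by simpa using (mem_sphere_zero_iff_norm.1 hz).le)).2 t ht u
  refine ⟨hsm, ?_, fun j => ?_, fun j => ?_⟩
  · have := h00.2 t ht u
    change ‖decaySymbol p t u _‖ ≤ _
    linarith
  · obtain ⟨A, h1, -, hd, hb⟩ := hline j
    rw [h1]
    have := Complex.norm_deriv_le_of_forall_mem_sphere_norm_le hδ hd hb
    linarith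
  · obtain ⟨A, -, h2, hd, hb⟩ := hline j
    rw [h2]
    have := Complex.norm_iteratedDeriv_le_of_forall_mem_sphere_norm_le 2 hδ hd hb
    rw [iteratedDeriv_succ, iteratedDeriv_one] at this
    simp only [Nat.factorial_two, Nat.cast_ofNat] at this
    linarith

end RealFrequencies

/-! ### Cutting off low frequencies -/

section CutOffSymbol

variable {F : Type*} [NormedAddCommGroup F] [NormedSpace ℝ F]

lemma pd_smul_apply {h : E3 → ℝ} {f : E3 → F} {x : E3} (hh : DifferentiableAt ℝ h x)
    (hf : DifferentiableAt ℝ f x) (j : Fin 3) :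
    pd j (fun y => h y • f y) x = h x • pd j f x + pd j h x • f x := by
  simp only [pd]
  rw [fderiv_fun_smul hh hf]
  simp

lemma pd_add_apply {f g : E3 → F} {x : E3} (hf : DifferentiableAt ℝ f x)
    (hg : DifferentiableAt ℝ g x) (j : Fin 3) :
    pd j (fun y => f y + g y) x = pd j f x + pd j g x := by
  simp only [pd]
  rw [fderiv_fun_add hf hg]
  simp

lemma pd_const_smul_apply {f : E3 → F} {x : E3} (hf : DifferentiableAt ℝ f x) (c : ℝ)
    (j : Fin 3) : pd j (fun y => c • f y) x = c • pd j f x := by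
  simp only [pd]
  rw [fderiv_fun_const_smul hf]
  simp

lemma differentiableAt_pd {f : E3 → F} {x : E3} (hf : ContDiffAt ℝ 2 f x) (j : Fin 3) :
    DifferentiableAt ℝ (pd j f) x := by
  unfold pd
  exact (((hf.fderiv_right (m := 1) (by norm_num)).differentiableAt one_ne_zero).clm_apply
    (differentiableAt_const _))

lemma pd_pd_smul_apply {h : E3 → ℝ} {f : E3 → F} {x : E3} (hh : ContDiff ℝ ∞ h)
    (hf : ContDiffAt ℝ 2 f x) (j : Fin 3) :
    pd j (pd j (fun y => h y • f y)) x = (h x • pd j (pd j f) x + pd j h x • pd j f x) +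
      (pd j h x • pd j f x + pd j (pd j h) x • f x) := by
  have hd : ∀ᶠ y in nhds x, DifferentiableAt ℝ f y := by
    filter_upwards [hf.eventually (by simp)] with y hy
    exact hy.differentiableAt (by simp)
  have e : pd j (fun y => h y • f y) =ᶠ[nhds x] fun y => h y • pd j f y + pd j h y • f y := by
    filter_upwards [hd] with y hy
    exact pd_smul_apply (hh.differentiable (by simp) y) hy j
  have d1 : DifferentiableAt ℝ h x := hh.differentiable (by simp) x
  have d2 : DifferentiableAt ℝ (pd j h) x := (contDiff_pd_infty hh j).differentiable (by simp) x
  have d3 := hd.self_of_nhds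
  have d4 := differentiableAt_pd hf j
  rw [(pd_congr e j).eq_of_nhds, pd_add_apply (d1.fun_smul d4) (d2.fun_smul d3),
    pd_smul_apply d1 d4, pd_smul_apply d2 d3]

lemma M₁_pos (p : Coeffs) : 0 < M₁ p := by
  have h1 := p.ν_pos
  have h2 := p.νt_pos
  have h3 := p.β_pos
  refine lt_min (by positivity) (div_pos (Real.sqrt_pos.2 (by positivity)) (by positivity))

/-- The symbol `1 - φ̂₁` of `P_∞`. -/
def CutOffs.tail {p : Coeffs} (χ : CutOffs p) (η : E3) : ℝ := 1 - χ.low η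

lemma CutOffs.contDiff_tail {p : Coeffs} (χ : CutOffs p) : ContDiff ℝ ∞ χ.tail :=
  contDiff_const.sub χ.low_smooth

lemma CutOffs.hasCompactSupport_low {p : Coeffs} (χ : CutOffs p) : HasCompactSupport χ.low := by
  refine HasCompactSupport.intro (isCompact_closedBall (0 : E3) (M₁ p / Real.sqrt 2))
    fun x hx => χ.low_zero x ?_
  rw [Metric.mem_closedBall, dist_zero_right, not_le] at hx
  exact hx.le

lemma CutOffs.exists_tail_bound {p : Coeffs} (χ : CutOffs p) : ∃ D > 0, ∀ j η,
    ‖χ.tail η‖ ≤ D ∧ ‖pd j χ.tail η‖ ≤ D ∧ ‖pd j (pd j χ.tail) η‖ ≤ D := by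
  have hneg : ∀ (f : E3 → ℝ) (c : ℝ) (j : Fin 3), pd j (fun x => c - f x) = fun x => -pd j f x :=
    fun f c j => by
      funext x
      simp only [pd, fderiv_const_sub, neg_apply]
  have e1 : ∀ j, pd j χ.tail = fun x => 0 - pd j χ.low x := fun j => by
    simp only [zero_sub]
    exact hneg _ _ _
  have e2 : ∀ j, pd j (pd j χ.tail) = fun x => -pd j (pd j χ.low) x := fun j => by
    rw [e1, hneg]
  have b1 : ∀ j, ∃ C, ∀ x, ‖pd j χ.low x‖ ≤ C := fun j =>
    exists_bound_of_hasCompactSupport (contDiff_pd_infty χ.low_smooth j).continuous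
      (hasCompactSupport_pd χ.hasCompactSupport_low j)
  have b2 : ∀ j, ∃ C, ∀ x, ‖pd j (pd j χ.low) x‖ ≤ C := fun j =>
    exists_bound_of_hasCompactSupport
      (contDiff_pd_infty (contDiff_pd_infty χ.low_smooth j) j).continuous
      (hasCompactSupport_pd (hasCompactSupport_pd χ.hasCompactSupport_low j) j)
  choose C1 hC1 using b1
  choose C2 hC2 using b2
  have n1 : ∀ j, 0 ≤ C1 j := fun j => (norm_nonneg _).trans (hC1 j 0)
  have n2 : ∀ j, 0 ≤ C2 j := fun j => (norm_nonneg _).trans (hC2 j 0)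
  have t1 : 0 ≤ ∑ j, C1 j := Finset.sum_nonneg fun j _ => n1 j
  have t2 : 0 ≤ ∑ j, C2 j := Finset.sum_nonneg fun j _ => n2 j
  refine ⟨1 + ∑ j, C1 j + ∑ j, C2 j, by positivity, fun j η => ⟨?_, ?_, ?_⟩⟩
  · have h := χ.low_mem η
    rw [CutOffs.tail, Real.norm_eq_abs, abs_le]
    constructor <;> linarith [h.1, h.2]
  · rw [e1]
    simp only [zero_sub, norm_neg]
    linarith [hC1 j η, Finset.single_le_sum (fun j _ => n1 j) (Finset.mem_univ j)]
  · rw [e2]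
    simp only [norm_neg]
    linarith [hC2 j η, Finset.single_le_sum (fun j _ => n2 j) (Finset.mem_univ j)]

/-- The symbol of `(1 - Δ)⁻¹ e^{-tL} P_∞` on constrained states, in the normalization of
Mathlib's Fourier transform. -/
def CutOffs.kernelSymbol {p : Coeffs} (χ : CutOffs p) (t : ℝ) (u : State) (ξ : E3) : State :=
  χ.tail ((2 * Real.pi) • ξ) • realDecaySymbol p t u ((2 * Real.pi) • ξ)

/-- The symbol vanishes identically on |η| < M₁/2, where Π is singular at the origin and no uniform
exponential decay is available; outside, the Leibniz rule combines the decay with the bounded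
cut-off. -/
lemma CutOffs.exists_kernelSymbol_bound {p : Coeffs} (χ : CutOffs p) :
    ∃ C > 0, ∃ c > 0, ∀ t ≥ 0, ∀ u : State, ContDiff ℝ 2 (χ.kernelSymbol t u) ∧
      (∀ ξ, ‖χ.kernelSymbol t u ξ‖ ≤ C * Real.exp (-c * t) * ‖u‖ * (1 + ‖ξ‖ ^ 2)⁻¹) ∧
      (∀ j ξ, ‖pd j (χ.kernelSymbol t u) ξ‖ ≤
        C * Real.exp (-c * t) * ‖u‖ * (1 + ‖ξ‖ ^ 2)⁻¹) ∧
      ∀ j ξ, ‖pd j (pd j (χ.kernelSymbol t u)) ξ‖ ≤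
        C * Real.exp (-c * t) * ‖u‖ * (1 + ‖ξ‖ ^ 2)⁻¹ := by
  have hρ₀ : 0 < M₁ p / 2 := half_pos (M₁_pos p)
  obtain ⟨C, hC, c, hc, H⟩ := exists_realDecaySymbol_bound p hρ₀
  obtain ⟨D, hD, hDb⟩ := χ.exists_tail_bound
  have hpi : 1 ≤ 2 * Real.pi := by linarith [Real.pi_gt_three]
  -- The 4 covers the four Leibniz terms of a second derivative, and (2π)² is the chain rule for the
  -- dilation η = 2πξ.
  refine ⟨(2 * Real.pi) ^ 2 * (4 * (D * C)), by positivity, c, hc, fun t ht u => ?_⟩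
  set f := realDecaySymbol p t u with hf
  let g : E3 → State := fun η => χ.tail η • f η
  set B := C * Real.exp (-c * t) * ‖u‖ with hB
  have hB0 : 0 ≤ B := by positivity
  have hzero : ∀ η : E3, ‖η‖ < M₁ p / 2 → g =ᶠ[nhds η] fun _ => 0 := fun η hη => by
    filter_upwards [(isOpen_lt continuous_norm continuous_const).mem_nhds hη] with y hy
    have h2 : ‖y‖ ≤ M₁ p / 2 := le_of_lt hy
    simp only [g, CutOffs.tail, χ.low_one y h2, sub_self, zero_smul]
  have hpd0 : ∀ j, pd j (fun _ : E3 => (0 : State)) = fun _ => 0 := fun j => by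
    funext x
    simp [pd]
  have hsm : ContDiff ℝ 2 g := by
    rw [contDiff_iff_contDiffAt]
    intro η
    rcases lt_or_ge ‖η‖ (M₁ p / 2) with h | h
    · exact contDiffAt_const.congr_of_eventuallyEq (hzero η h)
    · exact (χ.contDiff_tail.contDiffAt.of_le (by norm_cast)).smul
        ((H t ht u η h).1.of_le (by norm_cast))
  have hg : ∀ η, ‖g η‖ ≤ 4 * (D * B) * (1 + ‖η‖ ^ 2)⁻¹ ∧
      (∀ j, ‖pd j g η‖ ≤ 4 * (D * B) * (1 + ‖η‖ ^ 2)⁻¹) ∧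
      ∀ j, ‖pd j (pd j g) η‖ ≤ 4 * (D * B) * (1 + ‖η‖ ^ 2)⁻¹ := fun η => by
    have hpos : 0 ≤ D * (B * (1 + ‖η‖ ^ 2)⁻¹) := by positivity
    have e : 4 * (D * B) * (1 + ‖η‖ ^ 2)⁻¹ = 4 * (D * (B * (1 + ‖η‖ ^ 2)⁻¹)) := by ring
    rw [e]
    rcases lt_or_ge ‖η‖ (M₁ p / 2) with h | h
    · have h0 := hzero η h
      have h1 : ∀ j, pd j g =ᶠ[nhds η] fun _ => 0 := fun j => by
        have := pd_congr h0 j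
        rwa [hpd0] at this
      have h2 : ∀ j, pd j (pd j g) =ᶠ[nhds η] fun _ => 0 := fun j => by
        have := pd_congr (h1 j) j
        rwa [hpd0] at this
      refine ⟨?_, fun j => ?_, fun j => ?_⟩
      · rw [h0.eq_of_nhds, norm_zero]; linarith
      · rw [(h1 j).eq_of_nhds, norm_zero]; linarith
      · rw [(h2 j).eq_of_nhds, norm_zero]; linarith
    · obtain ⟨s, b0, b1, b2⟩ := H t ht u η h
      have hmul : ∀ {a : ℝ} {v : State}, ‖a‖ ≤ D → ‖v‖ ≤ B * (1 + ‖η‖ ^ 2)⁻¹ →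
          ‖a • v‖ ≤ D * (B * (1 + ‖η‖ ^ 2)⁻¹) := fun ha hv => by
        rw [norm_smul]; exact mul_le_mul ha hv (norm_nonneg _) hD.le
      have d1 : DifferentiableAt ℝ χ.tail η := χ.contDiff_tail.differentiable (by simp) η
      have d2 : DifferentiableAt ℝ f η := s.differentiableAt (by simp)
      refine ⟨?_, fun j => ?_, fun j => ?_⟩
      · linarith [hmul (hDb 0 η).1 b0]
      · have e1 : pd j g η = _ := pd_smul_apply d1 d2 j
        rw [e1]
        refine (norm_add_le _ _).trans ?_
        linarith [hmul (hDb j η).1 (b1 j), hmul (hDb j η).2.1 b0]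
      · have e1 : pd j (pd j g) η = _ :=
          pd_pd_smul_apply χ.contDiff_tail (s.of_le (by norm_cast)) j
        rw [e1]
        refine (norm_add_le _ _).trans ((add_le_add (norm_add_le _ _) (norm_add_le _ _)).trans ?_)
        linarith [hmul (hDb j η).1 (b2 j), hmul (hDb j η).2.1 (b1 j), hmul (hDb j η).2.2 b0]
  have hk : χ.kernelSymbol t u = fun ξ => g ((2 * Real.pi) • ξ) := rfl
  have hk1 : ∀ j, pd j (χ.kernelSymbol t u) =
      fun ξ => (2 * Real.pi) • pd j g ((2 * Real.pi) • ξ) := fun j => by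
    rw [hk, pd_comp_smul]
  have hsm1 : ∀ j, ContDiff ℝ 1 (pd j g) := fun j => by
    unfold pd
    exact (hsm.fderiv_right (m := 1) (by norm_num)).clm_apply contDiff_const
  have hk2 : ∀ j, pd j (pd j (χ.kernelSymbol t u)) =
      fun ξ => (2 * Real.pi) • (2 * Real.pi) • pd j (pd j g) ((2 * Real.pi) • ξ) := fun j => by
    funext ξ
    have hdiff : DifferentiableAt ℝ (fun ξ : E3 => pd j g ((2 * Real.pi) • ξ)) ξ :=
      ((hsm1 j).comp (contDiff_const_smul (2 * Real.pi))).differentiable one_ne_zero ξ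
    rw [hk1, pd_const_smul_apply hdiff, pd_comp_smul]
  have hdecay : ∀ (ξ : E3) (a : ℝ), 0 ≤ a → a ≤ (2 * Real.pi) ^ 2 →
      a * (4 * (D * B) * (1 + ‖(2 * Real.pi) • ξ‖ ^ 2)⁻¹) ≤
      (2 * Real.pi) ^ 2 * (4 * (D * C)) * Real.exp (-c * t) * ‖u‖ * (1 + ‖ξ‖ ^ 2)⁻¹ :=
    fun ξ a ha ha' => by
      have h1 : (1 + ‖(2 * Real.pi) • ξ‖ ^ 2)⁻¹ ≤ (1 + ‖ξ‖ ^ 2)⁻¹ := by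
        refine inv_anti₀ (by positivity) ?_
        rw [norm_smul, Real.norm_of_nonneg (by positivity)]
        have := pow_le_pow_left₀ (norm_nonneg ξ) (le_mul_of_one_le_left (norm_nonneg ξ) hpi) 2
        linarith
      have h2 := mul_le_mul ha' (mul_le_mul_of_nonneg_left h1 (by positivity : 0 ≤ 4 * (D * B)))
        (by positivity) (by positivity)
      refine h2.trans_eq ?_
      rw [hB]; ring
  refine ⟨hsm.comp (contDiff_const_smul (2 * Real.pi)), fun ξ => ?_, fun j ξ => ?_, fun j ξ => ?_⟩
  · have h1 := hdecay ξ 1 zero_le_one (one_le_pow₀ hpi)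
    rw [one_mul] at h1
    exact (hg ((2 * Real.pi) • ξ)).1.trans h1
  · rw [hk1]
    simp only
    rw [norm_smul, Real.norm_of_nonneg (by positivity)]
    exact (mul_le_mul_of_nonneg_left ((hg ((2 * Real.pi) • ξ)).2.1 j) (by positivity)).trans
      (hdecay ξ _ (by positivity) (le_self_pow₀ hpi two_ne_zero))
  · rw [hk2]
    simp only
    rw [smul_smul, norm_smul, Real.norm_of_nonneg (by positivity)]
    exact (mul_le_mul_of_nonneg_left ((hg ((2 * Real.pi) • ξ)).2.2 j) (by positivity)).trans
      (hdecay ξ _ (by positivity) (by rw [sq]))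

end CutOffSymbol

/-! ### The evolution as a convolution -/

section Assembly

variable {F : Type*} [NormedAddCommGroup F] [NormedSpace ℂ F]

lemma integral_norm_convolution_le {f : E3 → ℂ} {g : E3 → F} (hf : Integrable f)
    (hg : Integrable g) :
    ∫ x, ‖convolution f g (ContinuousLinearMap.lsmul ℂ ℂ) volume x‖ ≤
      (∫ x, ‖f x‖) * ∫ x, ‖g x‖ := by
  have h1 := hf.norm.integrable_convolution (ContinuousLinearMap.mul ℝ ℝ) hg.norm
  have h2 := integral_convolution (ContinuousLinearMap.mul ℝ ℝ) hf.norm hg.norm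
  rw [ContinuousLinearMap.mul_apply'] at h2
  rw [← h2]
  refine integral_mono (hf.integrable_convolution (ContinuousLinearMap.lsmul ℂ ℂ) hg).norm h1
    fun x => ?_
  simp only [convolution]
  refine (norm_integral_le_integral_norm _).trans_eq ?_
  simp [norm_smul]

lemma fourier_multiplier {m : E3 → State →L[ℂ] State} (hm : Continuous m)
    (hb : ∃ C : ℝ, ∀ ξ, ‖m ξ‖ ≤ C) (u : L2State) :
    (𝓕 (multiplier m hm hb u) : L2State) =ᵐ[volume]
      fun ξ => m ((2 * Real.pi) • ξ) ((𝓕 u : L2State) ξ) := by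
  rw [multiplier, fourier_fourierInv_eq]
  exact (memLp_multiplier hm hb u).coeFn_toLp

lemma CutOffs.projSymbol_apply {p : Coeffs} (χ : CutOffs p) (ξ : E3) (u : State) :
    χ.projSymbol ξ u = χ.tail ξ • u := by
  simp [CutOffs.projSymbol, CutOffs.mid, CutOffs.tail]

lemma fourier_semigroup_projInfty {p : Coeffs} (χ : CutOffs p) (t : ℝ≥0) (u : L2State) :
    (𝓕 (semigroup p t (projInfty χ u)) : L2State) =ᵐ[volume]
      fun ξ => semigroupSymbol p t ((2 * Real.pi) • ξ)
        (χ.tail ((2 * Real.pi) • ξ) • (𝓕 u : L2State) ξ) := by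
  filter_upwards [fourier_multiplier (continuous_semigroupSymbol p t)
    (bounded_semigroupSymbol p t) (projInfty χ u), fourier_multiplier χ.continuous_projSymbol
    χ.bounded_projSymbol u] with ξ h1 h2
  rw [semigroup, h1]
  change _ = (χ.projSymbol ((2 * Real.pi) • ξ)) ((𝓕 u : L2State) ξ) at h2
  rw [← χ.projSymbol_apply, ← h2]
  rfl

/-- Linearity splits the operator-valued kernel into thirteen vector-valued ones, each convolved
with a scalar component of V. -/
lemma constraintProj_sum_single (ζ : Fin 3 → ℂ) (u : State) :
    constraintProj ζ u = ∑ b, u b • constraintProj ζ (EuclideanSpace.single b 1) := by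
  let T : State →ₗ[ℂ] State :=
    { toFun := constraintProj ζ
      map_add' := fun u v => by
        ext c
        rcases c with ⟨⟩ | j | ⟨j, k⟩
        · simp only [constraintProj, tens, PiLp.add_apply, Fin.sum_univ_three]
          ring
        · rfl
        · simp only [constraintProj, tens, PiLp.add_apply, Fin.sum_univ_three]
          ring
      map_smul' := fun a u => by
        ext c
        rcases c with ⟨⟩ | j | ⟨j, k⟩
        · simp only [constraintProj, tens, PiLp.smul_apply, smul_eq_mul, Fin.sum_univ_three,
            RingHom.id_apply]
          ring
        · rfl
        · simp only [constraintProj, tens, PiLp.smul_apply, smul_eq_mul, Fin.sum_univ_three,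
            RingHom.id_apply]
          ring }
  have hu : u = ∑ b, u b • EuclideanSpace.single b (1 : ℂ) := by
    ext c
    rw [WithLp.ofLp_sum, Finset.sum_apply, Finset.sum_eq_single c]
    · simp
    · intro b _ hb
      simp [hb.symm]
    · simp
  change T u = ∑ b, u b • T (EuclideanSpace.single b 1)
  conv_lhs => rw [hu]
  simp only [map_sum, map_smul]

lemma sum_smul_kernelSymbol {p : Coeffs} (χ : CutOffs p) (t : ℝ) (u : State) (ξ : E3) :
    ∑ b, u b • χ.kernelSymbol t (EuclideanSpace.single b 1) ξ = χ.kernelSymbol t u ξ := by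
  simp only [CutOffs.kernelSymbol, realDecaySymbol, decaySymbol]
  conv_rhs => rw [constraintProj_sum_single, map_sum, Finset.smul_sum, Finset.smul_sum]
  refine Finset.sum_congr rfl fun b _ => ?_
  rw [map_smul, smul_comm (u b), smul_comm (u b)]

lemma sum_ofReal_sq (η : E3) : ∑ l, (η l : ℂ) ^ 2 = ((‖η‖ ^ 2 : ℝ) : ℂ) := by
  rw [EuclideanSpace.norm_sq_eq]
  push_cast
  exact Finset.sum_congr rfl fun l _ => by
    rw [← Complex.ofReal_pow, ← Complex.ofReal_pow, Real.norm_eq_abs, sq_abs]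

lemma CutOffs.tail_zero {p : Coeffs} (χ : CutOffs p) : χ.tail 0 = 0 := by
  rw [CutOffs.tail, χ.low_one 0 (by simpa using (half_pos (M₁_pos p)).le), sub_self]

/-- On a constrained state the projection is the identity, and 1 + |η|² cancels the factor (1 +
η·η)⁻¹. At ξ = 0, where the projection degenerates, the cut-off annihilates both sides. -/
lemma kernelSymbol_of_constrained {p : Coeffs} (χ : CutOffs p) (t : ℝ≥0) (u : State) (ξ : E3)
    (hu : Constrained (fun l => (((2 * Real.pi) • ξ) l : ℂ)) u) :
    χ.kernelSymbol t ((1 + ‖(2 * Real.pi) • ξ‖ ^ 2) • u) ξ =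
      semigroupSymbol p t ((2 * Real.pi) • ξ) (χ.tail ((2 * Real.pi) • ξ) • u) := by
  rcases eq_or_ne ξ 0 with rfl | hξ
  · simp [CutOffs.kernelSymbol, χ.tail_zero]
  set η : E3 := (2 * Real.pi) • ξ with hη
  have hη0 : η ≠ 0 := smul_ne_zero (by positivity) hξ
  have hz : ∑ l, (η l : ℂ) ^ 2 ≠ 0 := by
    rw [sum_ofReal_sq]
    exact_mod_cast pow_ne_zero 2 (norm_ne_zero_iff.2 hη0)
  have hz1 : ((1 + ‖η‖ ^ 2 : ℝ) : ℂ) ≠ 0 := by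
    have : (0 : ℝ) < 1 + ‖η‖ ^ 2 := by positivity
    exact_mod_cast this.ne'
  have hscale : ∀ a : ℂ, Constrained (fun l => (η l : ℂ)) (a • u) := fun a => by
    have e1 : phi (a • u) = a * phi u := rfl
    have e2 : ∀ j k, tens (a • u) j k = a * tens u j k := fun _ _ => rfl
    constructor
    · simp only [e1, e2]
      rw [← Finset.mul_sum, ← mul_add, hu.1, mul_zero]
    · intro j k
      have h := hu.2 j k
      simp only [e2, mul_assoc, ← Finset.mul_sum]
      linear_combination a * h
  have hc : (1 + ‖η‖ ^ 2) • u = ((1 + ‖η‖ ^ 2 : ℝ) : ℂ) • u := (Complex.coe_smul _ _).symm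
  rw [CutOffs.kernelSymbol, ← hη, realDecaySymbol, decaySymbol, hc,
    constraintProj_eq_self hz (hscale _), map_smul, smul_smul, sum_ofReal_sq]
  have e : (1 + ((‖η‖ ^ 2 : ℝ) : ℂ))⁻¹ * ((1 + ‖η‖ ^ 2 : ℝ) : ℂ) = 1 := by
    rw [← Complex.ofReal_one, ← Complex.ofReal_add]
    exact inv_mul_cancel₀ hz1
  rw [e, one_smul, csymbol_ofReal, ← Complex.coe_smul, ← Complex.coe_smul, map_smul]
  rfl

/-- The relation ξ_l Ĝʲᵏ = ξ_k Ĝʲˡ, multiplied by ξ_l and summed over l, is the quadratic form of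
the constraint. -/
lemma constrained_fourier {U : E3 → State} (hU : Integrable U)
    (hT : ∀ᵐ x, phi (U x) + ∑ k, tens (U x) k k = 0)
    (hG : IsGradient fun x => tens (U x)) (ξ : E3) :
    Constrained (fun l => (((2 * Real.pi) • ξ) l : ℂ)) (𝓕 U ξ) := by
  refine ⟨fourier_trace hU hT ξ, fun j k => ?_⟩
  rw [Finset.sum_mul, Finset.sum_mul]
  refine Finset.sum_congr rfl fun l _ => ?_
  have h := fourier_tens_of_isGradient hU hG j k l ξ
  simp only [PiLp.smul_apply, smul_eq_mul]
  push_cast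
  linear_combination (2 * Real.pi) ^ 2 * (ξ l : ℂ) * h

end Assembly

end

end Viscoelastic

open Viscoelastic in
theorem proposition4p3 (p : Viscoelastic.Coeffs) (χ : Viscoelastic.CutOffs p) :
    ∃ C > 0, ∃ c > 0, ∀ U₀ : Viscoelastic.E3 → Viscoelastic.State,
      Viscoelastic.MemW1 2 U₀ →
      (∀ᵐ x, Viscoelastic.phi (U₀ x) + ∑ k, Viscoelastic.tens (U₀ x) k k = 0) →
      Viscoelastic.IsGradient (fun x => Viscoelastic.tens (U₀ x)) →
      ∃ h : MemLp U₀ 2 volume, ∀ t : ℝ≥0, 0 < t →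
        Integrable (Viscoelastic.semigroup p t (Viscoelastic.projInfty χ (h.toLp U₀))) volume ∧
        ∫ x, ‖Viscoelastic.semigroup p t (Viscoelastic.projInfty χ (h.toLp U₀)) x‖ ≤
          C * Real.exp (-c * t) * Viscoelastic.normW1 2 U₀ := by
  obtain ⟨C₁, hC₁, c, hc, hk⟩ := χ.exists_kernelSymbol_bound
  obtain ⟨C₂, hC₂, hK⟩ := exists_integrable_kernel (F := State)
  refine ⟨13 * (C₂ * C₁), by positivity, c, hc, fun U₀ hU hT hG => ?_⟩
  refine ⟨memLp_two_of_memW1 hU, fun t _ => ?_⟩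
  set h := memLp_two_of_memW1 hU
  obtain ⟨V, hV, hVF, hVn⟩ := hU.exists_bessel
  -- One kernel per basis vector, including basis vectors that violate the constraints: the
  -- projection inside the symbol is what makes them decay.
  have hk' := fun b : Comp => hk t t.2 (EuclideanSpace.single b 1)
  have hnorm : ∀ b : Comp, ‖(EuclideanSpace.single b 1 : State)‖ = 1 := fun b => by simp
  simp only [hnorm, mul_one] at hk'
  set B := C₁ * Real.exp (-c * t) with hB
  have hBp : 0 < B := by positivity
  have hK' := fun b : Comp => hK B hBp _ (hk' b).1 (hk' b).2.1 (hk' b).2.2.1 (hk' b).2.2.2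
  choose K hKi hKF hKn using hK'
  let Vc : Comp → E3 → ℂ := fun b x => V x b
  have hVc : ∀ b, Integrable (Vc b) := fun b =>
    (EuclideanSpace.proj (𝕜 := ℂ) b).integrable_comp hV
  have hVcF : ∀ b ξ, 𝓕 (Vc b) ξ = (𝓕 V ξ) b := fun b ξ =>
    fourier_clm_apply (EuclideanSpace.proj (𝕜 := ℂ) b) hV ξ
  let R : Comp → E3 → State := fun b =>
    convolution (Vc b) (K b) (ContinuousLinearMap.lsmul ℂ ℂ) volume
  have hR : ∀ b, Integrable (R b) := fun b =>
    (hVc b).integrable_convolution (ContinuousLinearMap.lsmul ℂ ℂ) (hKi b)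
  have hS : Integrable fun x => ∑ b, R b x := integrable_finsetSum _ fun b _ => hR b
  have hSF : ∀ ξ, 𝓕 (fun x => ∑ b, R b x) ξ = ∑ b, (𝓕 V ξ) b • 𝓕 (K b) ξ := fun ξ => by
    rw [fourier_finset_sum _ fun b _ => hR b]
    refine Finset.sum_congr rfl fun b _ => ?_
    rw [← hVcF]
    exact Real.fourier_smul_convolution_eq (hVc b) (hKi b) ξ
  -- Only here are the hypotheses on φ and G used, to identify the convolution with the actual
  -- evolution; its L¹ bound holds for any V.
  have hae : (fun x => ∑ b, R b x) =ᵐ[volume] semigroup p t (projInfty χ (h.toLp U₀)) := by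
    refine ae_eq_of_fourier_ae_eq hS _ ?_
    filter_upwards [fourier_semigroup_projInfty χ t (h.toLp U₀),
      fourier_toLp_ae_eq hU.integrable h, ae_all_iff.2 hKF] with ξ h1 h2 h3
    rw [h1, h2, hSF]
    simp only [h3]
    rw [sum_smul_kernelSymbol, hVF,
      kernelSymbol_of_constrained χ t _ ξ (constrained_fourier hU.integrable hT hG ξ)]
  refine ⟨hS.congr hae, ?_⟩
  have hVcn : ∀ b, ∫ x, ‖Vc b x‖ ≤ ∫ x, ‖V x‖ := fun b =>
    integral_mono (hVc b).norm hV.norm fun x => PiLp.norm_apply_le (V x) b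
  have hn0 : 0 ≤ ∫ x, ‖V x‖ := integral_nonneg fun x => norm_nonneg _
  calc ∫ x, ‖semigroup p t (projInfty χ (h.toLp U₀)) x‖ = ∫ x, ‖∑ b, R b x‖ := by
        refine integral_congr_ae ?_
        filter_upwards [hae] with x hx
        rw [hx]
    _ ≤ ∫ x, ∑ b, ‖R b x‖ := integral_mono hS.norm
        (integrable_finsetSum _ fun b _ => (hR b).norm) fun x => norm_sum_le _ _
    _ = ∑ b, ∫ x, ‖R b x‖ := integral_finsetSum _ fun b _ => (hR b).norm
    _ ≤ ∑ _b : Comp, normW1 2 U₀ * (C₂ * B) := by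
        refine Finset.sum_le_sum fun b _ => ?_
        refine (integral_norm_convolution_le (hVc b) (hKi b)).trans ?_
        exact mul_le_mul ((hVcn b).trans hVn) (hKn b) (integral_nonneg fun x => norm_nonneg _)
          (hn0.trans hVn)
    _ = 13 * (C₂ * C₁) * Real.exp (-c * t) * normW1 2 U₀ := by
        simp [hB]
        ring
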